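/- Let $n>p\ge 0$ be integers, let $\lambda$ be an indeterminate over $\mathbb{C}$, and let $P=(x+1)^n-\lambda x^p\in\mathbb{C}(\lambda)[x]$. Let $\mathrm{Gal}(P,\mathbb{C}(\lambda))$ be the Galois group of the splitting field of $P$ over $\mathbb{C}(\lambda)$, acting on the set of roots of $P$ in that field. 1. If $\gcd(n,p)=1$, then $P$ has $n$ distinct roots in its splitting field and $\mathrm{Gal}(P,\mathbb{C}(\lambda))$ is the full symmetric group $S_n$ on them; that is, the action on the roots is an isomorphism onto the group of all permutations of the roots. 2. In general, let $t=\gcd(n,p)$. Then $P$ has $n$ distinct roots, and they can be labelled bijectively by $\mathbb{Z}/n\mathbb{Z}$ so that $\mathrm{Gal}(P,\mathbb{C}(\lambda))$, as a group of permutations of the labels, is generated by the $n$-cycle $i\mapsto i+1$ and the transposition $(a,\,a+p)$ for some $a\in\mathbb{Z}/n\mathbb{Z}$ (for $p=0$ this second generator is the identity). With the same labelling it is also generated by the $n$-cycle $i\mapsto i+1$ and the transposition $(1,\,1+t)$ (again the identity if $p=0$). Moreover, $\mathrm{Gal}(P,\mathbb{C}(\lambda))$ is an extension of the cyclic group $C_t$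 of order $t$ by $(S_{n/t})^t$: there is a short exact sequence of groups $$1\to (S_{n/t})^t\to \mathrm{Gal}(P,\mathbb{C}(\lambda))\to C_t\to 1 .$$ -/

import Mathlib

open Polynomial

/-- The polynomial `P = (x + 1)ⁿ - λ xᵖ` in the unknown `x`, with coefficients in the field
`ℂ(λ)` of rational functions; the parameter `λ` is `RatFunc.X`. -/
noncomputable def parametricPoly (n p : ℕ) : (RatFunc ℂ)[X] :=
  (X + 1) ^ n - C RatFunc.X * X ^ p

/-- The roots of `P` in its splitting field over `ℂ(λ)`. -/
abbrev ParametricRoots (n p : ℕ) : Type :=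
  (parametricPoly n p).rootSet (parametricPoly n p).SplittingField

/-- The Galois group `Gal(P, ℂ(λ))` of the splitting field of `P`, acting on the roots of `P`. -/
noncomputable def rootAction (n p : ℕ) :
    (parametricPoly n p).Gal →* Equiv.Perm (ParametricRoots n p) :=
  MulAction.toPermHom (parametricPoly n p).Gal (ParametricRoots n p)

/-- `Gal(P, ℂ(λ))` as a group of permutations of the labels, for a labelling `x` of the roots of
`P` by the integers modulo `n`. -/
noncomputable def labelledGaloisGroup (n p : ℕ) (x : ZMod n ≃ ParametricRoots n p) :
    Subgroup (Equiv.Perm (ZMod n)) :=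
  ((x.symm.permCongrHom : Equiv.Perm (ParametricRoots n p) ≃* Equiv.Perm (ZMod n)).toMonoidHom.comp
    (rootAction n p)).range

/-!
In the coordinate `z = 1 / (x + 1)` the equation `(x + 1) ^ n = λ x ^ p` becomes
`z ^ (n - p) * (z - 1) ^ p = ν` with `ν = (-1) ^ p / λ`, so the roots `z` are integral over `ℂ[ν]`.
Let `t = gcd n p`, `n - p = t a`, `p = t b`, and let `W z = z ^ a * (z - 1) ^ b`.  Then `W z` is a
`t`-th root of `ν`, so the values of `W` at the roots differ by `t`-th roots of unity in `ℂ`.  They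
cut the roots into `t` blocks of size `n / t` indexed by `ZMod t`, and every element of the Galois
group shifts the index by a constant.  The point is that every such permutation occurs
(`exists_range_eq_shiftGroup`); the generators and the exact sequence then follow by group theory
(`closure_addRight_swap`, `nonempty_groupExtension_of_range_eq`).  Since the group is transitive
(`exists_smul_eq_of_isRootFamily`), it is enough to find all transpositions inside a block.

These come from the decomposition groups `D` of primes `Q` of the integral closure of `ℂ[ν]`.  The
only fact about ramification needed is `primeOrd_dvd_of_stabilizer_fixed`: an element fixed by `D`
has an order at `Q` divisible by the order of the prime of `ℂ[ν]` below `Q`.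

If `p = 0` each block is a single root.  If `p > 0`, exactly two roots meet over the critical value
of `z ^ (n - p) * (z - 1) ^ p` at its simple critical point, and `D` contains their transposition
(`exists_swap_mem_range`).

Over `ν = 0`, exactly `n - p` roots reduce to `0` and `p` roots reduce to `1`, and `D` is transitive
on either set (`ncard_orbit_stabilizer`).  Call two roots equivalent if their transposition is in
the group; the classes are of equal size at least `2`, and lie inside blocks.  If no class contains
roots of both kinds, the size of a class divides the number of roots of either kind in a block, that
is, `a` and `b`, which are coprime: a contradiction.  If `z` reduces to `0` and `z'` to `1` in one
class, then the orbit of `z'` under the stabilizer of `z` in `D` lies in that class; as `a` and `b`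
are coprime it has at least `b` elements, and symmetrically there are at least `a` elements of the
other kind.  So the class is a whole block (`swap_mem_range_of_blockValue_eq`).
-/

/-! ### Orders at a prime of a Dedekind domain -/

/-- The order of `x` at the prime `Q`: the largest `k` with `x ∈ Q ^ k`.  It is meaningful for
`x ≠ 0` only. -/
noncomputable def primeOrd {S : Type*} [CommRing S] (Q : Ideal S) (x : S) : ℕ :=
  multiplicity Q (Ideal.span {x})

section PrimeOrd

variable {S : Type*} [CommRing S] [IsDedekindDomain S] {Q : Ideal S} [hQ : Q.IsPrime]

theorem finiteMultiplicity_span (h0 : Q ≠ ⊥) {x : S} (hx : x ≠ 0) :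
    FiniteMultiplicity Q (Ideal.span {x}) :=
  FiniteMultiplicity.of_prime_left (Ideal.prime_of_isPrime h0 hQ) (by simpa using hx)

theorem mem_pow_iff_le_primeOrd (h0 : Q ≠ ⊥) {x : S} (hx : x ≠ 0) (k : ℕ) :
    x ∈ Q ^ k ↔ k ≤ primeOrd Q x := by
  rw [primeOrd, ← (finiteMultiplicity_span h0 hx).pow_dvd_iff_le_multiplicity,
    Ideal.dvd_iff_le, Ideal.span_singleton_le_iff_mem]

theorem primeOrd_pos_iff (h0 : Q ≠ ⊥) {x : S} (hx : x ≠ 0) : 0 < primeOrd Q x ↔ x ∈ Q := by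
  rw [← pow_one Q, mem_pow_iff_le_primeOrd (by simpa using h0) hx, pow_one]; exact Iff.rfl

theorem primeOrd_mul (h0 : Q ≠ ⊥) {x y : S} (hx : x ≠ 0) (hy : y ≠ 0) :
    primeOrd Q (x * y) = primeOrd Q x + primeOrd Q y := by
  rw [primeOrd, ← Ideal.span_singleton_mul_span_singleton]
  exact multiplicity_mul (Ideal.prime_of_isPrime h0 hQ) (by
    rw [Ideal.span_singleton_mul_span_singleton]
    exact finiteMultiplicity_span h0 (mul_ne_zero hx hy))

theorem primeOrd_prod (h0 : Q ≠ ⊥) {ι : Type*} (s : Finset ι) (f : ι → S) (hf : ∀ i ∈ s, f i ≠ 0) :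
    primeOrd Q (∏ i ∈ s, f i) = ∑ i ∈ s, primeOrd Q (f i) := by
  classical
  induction s using Finset.induction_on with
  | empty =>
    rw [Finset.prod_empty, Finset.sum_empty, ← Nat.le_zero, ← not_lt,
      primeOrd_pos_iff h0 one_ne_zero]
    exact fun h => hQ.ne_top ((Ideal.eq_top_iff_one Q).2 h)
  | insert a s ha ih =>
    rw [Finset.prod_insert ha, Finset.sum_insert ha, primeOrd_mul h0 (hf a (by simp))
      (Finset.prod_ne_zero_iff.2 fun i hi => hf i (by simp [hi])),
      ih fun i hi => hf i (by simp [hi])]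

theorem primeOrd_pow (h0 : Q ≠ ⊥) {x : S} (hx : x ≠ 0) (k : ℕ) :
    primeOrd Q (x ^ k) = k * primeOrd Q x := by
  have := primeOrd_prod h0 (Finset.range k) (fun _ => x) (fun _ _ => hx)
  simpa using this

theorem primeOrd_eq_zero (h0 : Q ≠ ⊥) {x : S} (hx : x ∉ Q) : primeOrd Q x = 0 := by
  have hx0 : x ≠ 0 := fun h => hx (h ▸ Q.zero_mem)
  by_contra h
  exact hx ((primeOrd_pos_iff h0 hx0).1 (Nat.pos_of_ne_zero h))

theorem primeOrd_eq_of_sub_mem (h0 : Q ≠ ⊥) {x y : S} (hx : x ≠ 0)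
    (h : y - x ∈ Q ^ (primeOrd Q x + 1)) : y ≠ 0 ∧ primeOrd Q y = primeOrd Q x := by
  have hxn : x ∉ Q ^ (primeOrd Q x + 1) := by
    rw [mem_pow_iff_le_primeOrd h0 hx]; omega
  have hyn : y ∉ Q ^ (primeOrd Q x + 1) := fun hy => hxn (by
    have := Ideal.sub_mem _ hy h; simpa using this)
  have hy0 : y ≠ 0 := fun hy => hyn (hy ▸ Ideal.zero_mem _)
  have hy : y ∈ Q ^ primeOrd Q x := by
    have h1 := Ideal.add_mem _ (Ideal.pow_le_pow_right (Nat.le_succ _) h)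
      ((mem_pow_iff_le_primeOrd h0 hx _).2 le_rfl)
    simpa using h1
  rw [mem_pow_iff_le_primeOrd h0 hy0] at hy hyn
  exact ⟨hy0, by omega⟩

end PrimeOrd

open scoped Pointwise in
/-- An element fixed by the decomposition group, congruent to `1` modulo a power of `Q` and lying in
every other conjugate of `Q`. -/
theorem exists_prod_stabilizer_congr {S G : Type*} [CommRing S] [IsDedekindDomain S]
    [Group G] [Finite G] [MulSemiringAction G S] {Q : Ideal S} [hQ : Q.IsPrime] (h0 : Q ≠ ⊥)
    (N : ℕ) :
    ∃ u : S, (∀ g ∈ MulAction.stabilizer G Q, g • u = u) ∧ u - 1 ∈ Q ^ N ∧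
      ∀ g ∉ MulAction.stabilizer G Q, u ∈ g • Q := by
  classical
  cases nonempty_fintype G
  set D := MulAction.stabilizer G Q
  have hmax : Q.IsMaximal := hQ.isMaximal h0
  have hcop : IsCoprime (Q ^ N) (∏ g : G with g ∉ D, g • Q) := by
    refine IsCoprime.prod_right fun g hg => IsCoprime.pow_left ?_
    have hgQ : (g • Q).IsMaximal := by
      have : (g • Q).IsPrime := inferInstance
      refine this.isMaximal ?_
      rintro h
      apply h0
      have := congrArg (g⁻¹ • ·) h
      simpa using this
    refine Ideal.isCoprime_of_isMaximal fun h => ?_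
    exact (Finset.mem_filter.1 hg).2 (MulAction.mem_stabilizer_iff.2 h.symm)
  obtain ⟨s, hs, s', hs', hss⟩ := Ideal.isCoprime_iff_exists.1 hcop
  have hs'J : ∀ g ∉ D, s' ∈ g • Q := fun g hg =>
    (Ideal.prod_le_inf.trans (Finset.inf_le (f := fun g : G => g • Q)
      (Finset.mem_filter.2 ⟨Finset.mem_univ g, hg⟩))) hs'
  refine ⟨∏ d : D, (d : G) • s', fun g hg => ?_, ?_, fun g hg => ?_⟩
  · rw [Finset.smul_prod']
    exact Fintype.prod_equiv (Equiv.mulLeft (⟨g, hg⟩ : D)) _ _ fun d => by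
      simp [mul_smul]
  · rw [← Ideal.Quotient.eq_zero_iff_mem, map_sub, map_prod, map_one, sub_eq_zero]
    refine Finset.prod_eq_one fun d _ => ?_
    rw [← map_one (Ideal.Quotient.mk (Q ^ N)), Ideal.Quotient.mk_eq_mk_iff_sub_mem]
    have : (d : G) • s' - 1 = -((d : G) • s) := by
      rw [← eq_sub_iff_add_eq'] at hss
      rw [hss, smul_sub, smul_one]; ring
    rw [this]
    refine neg_mem ?_
    have h2 : (d : G) • s ∈ (d : G) • (Q ^ N) := Ideal.smul_mem_pointwise_smul_iff.2 hs
    have h3 : (d : G) • (Q ^ N) = Q ^ N := by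
      rw [smul_pow', MulAction.mem_stabilizer_iff.1 d.2]
    rwa [h3] at h2
  · refine Ideal.mem_of_dvd _ (Finset.dvd_prod_of_mem _ (Finset.mem_univ (1 : D))) ?_
    simpa using hs'J g hg

open scoped Pointwise in
/-- Elements fixed by the decomposition group of `Q` have orders at `Q` divisible by that of the
base prime `π`: the decomposition field is unramified over the base at the prime below `Q`.  The
element is modified away from `Q` to be `1` at the other conjugates of `Q`; the product of its
conjugates under coset representatives then lies in the base ring and keeps its order at `Q`. -/
theorem primeOrd_dvd_of_stabilizer_fixed
    {R S G : Type*} [CommRing R] [IsDomain R] [IsPrincipalIdealRing R] [CommRing S]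
    [IsDedekindDomain S] [Algebra R S] [FaithfulSMul R S] [Group G] [Finite G]
    [MulSemiringAction G S] [Algebra.IsInvariant R S G]
    {π : R} (hπ : Prime π) {Q : Ideal S} [hQ : Q.IsPrime] (hπQ : algebraMap R S π ∈ Q)
    {θ : S} (hθ : θ ≠ 0) (hfix : ∀ g ∈ MulAction.stabilizer G Q, g • θ = θ) :
    primeOrd Q (algebraMap R S π) ∣ primeOrd Q θ := by
  classical
  cases nonempty_fintype G
  set D := MulAction.stabilizer G Q
  have hπ0 : algebraMap R S π ≠ 0 := by
    simpa using hπ.ne_zero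
  have h0 : Q ≠ ⊥ := fun h => hπ0 (by simpa [h] using hπQ)
  obtain ⟨u, huD, hu1, huJ⟩ := exists_prod_stabilizer_congr (G := G) h0 (primeOrd Q θ + 1)
  set η := 1 + (θ - 1) * u with hη
  have hηD : ∀ g ∈ D, g • η = η := fun g hg => by
    rw [hη, smul_add, smul_mul', smul_sub, smul_one, hfix g hg, huD g hg]
  obtain ⟨hη0, hηord⟩ := primeOrd_eq_of_sub_mem h0 hθ (y := η) (by
    have : η - θ = (θ - 1) * (u - 1) := by rw [hη]; ring
    rw [this]; exact Ideal.mul_mem_left _ _ hu1)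
  let F : G ⧸ D → S := fun c => c.out • η
  have hF : ∀ g : G, F (QuotientGroup.mk g) = g • η := fun g => by
    obtain ⟨d, hd⟩ := QuotientGroup.mk_out_eq_mul D g
    change (QuotientGroup.mk g : G ⧸ D).out • η = _
    rw [hd, mul_smul, hηD d d.2]
  have hinv : ∀ g : G, g • ∏ c, F c = ∏ c, F c := fun g => by
    rw [Finset.smul_prod']
    refine Fintype.prod_equiv (MulAction.toPerm g) _ _ fun c => ?_
    induction c using QuotientGroup.induction_on with
    | H x =>
      rw [MulAction.toPerm_apply, hF, ← mul_smul, ← smul_eq_mul, ← hF]; rfl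
  obtain ⟨r, hr⟩ := Algebra.IsInvariant.isInvariant (A := R) _ hinv
  have hF0 : ∀ c, F c ≠ 0 := fun c => (smul_ne_zero_iff_ne _).2 hη0
  have hord : primeOrd Q (∏ c, F c) = primeOrd Q θ := by
    rw [primeOrd_prod h0 _ _ fun c _ => hF0 c,
      Finset.sum_eq_single (QuotientGroup.mk 1 : G ⧸ D)]
    · rw [hF, one_smul, hηord]
    · intro c _ hc
      induction c using QuotientGroup.induction_on with
      | H x =>
        rw [hF]
        refine primeOrd_eq_zero h0 fun hx => ?_
        have hxD : x⁻¹ ∉ D := fun h => hc (by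
          rw [eq_comm, QuotientGroup.eq]; simpa using inv_mem h)
        have h1 : η ∈ x⁻¹ • Q := by
          rw [Ideal.mem_inv_pointwise_smul_iff]; exact hx
        have h2 : (1 : S) ∈ x⁻¹ • Q := by
          have := Ideal.sub_mem _ h1 (Ideal.mul_mem_left _ (θ - 1) (huJ _ hxD))
          simpa [hη] using this
        have h3 : (x⁻¹ • Q).IsPrime := inferInstance
        exact h3.ne_top ((Ideal.eq_top_iff_one _).2 h2)
    · simp
  have hr0 : r ≠ 0 := by
    rintro rfl
    exact Finset.prod_ne_zero_iff.2 (fun c _ => hF0 c) (hr.symm.trans (map_zero _))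
  obtain ⟨c, hc, hdvd⟩ :=
    (FiniteMultiplicity.of_prime_left hπ hr0).exists_eq_pow_mul_and_not_dvd
  have hcQ : algebraMap R S c ∉ Q := by
    intro hcQ
    have hcop : IsCoprime π c := (hπ.irreducible.coprime_iff_not_dvd).2 hdvd
    obtain ⟨x, y, hxy⟩ := hcop
    apply hQ.ne_top
    rw [Ideal.eq_top_iff_one, ← map_one (algebraMap R S), ← hxy, map_add, map_mul, map_mul]
    exact Ideal.add_mem _ (Ideal.mul_mem_left _ _ hπQ) (Ideal.mul_mem_left _ _ hcQ)
  rw [← hord, ← hr, hc, map_mul, map_pow, primeOrd_mul h0 (pow_ne_zero _ hπ0)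
    (fun h => hcQ (by rw [h]; exact Q.zero_mem)), primeOrd_pow h0 hπ0, primeOrd_eq_zero h0 hcQ,
    add_zero]
  exact dvd_mul_left _ _

/-! ### Roots of `z ^ a * (z - 1) ^ b = ν` over a point of the line -/

/-- The constants `ℂ` inside a `ℂ[X]`-algebra. -/
noncomputable def constHom (S : Type*) [CommRing S] [Algebra ℂ[X] S] : ℂ →+* S :=
  (algebraMap ℂ[X] S).comp C

/-- The image of the parameter `X` in a `ℂ[X]`-algebra. -/
noncomputable def param (S : Type*) [CommRing S] [Algebra ℂ[X] S] : S := algebraMap ℂ[X] S X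

/-- A finite `G`-set `Z` identified, through `ι`, with the roots in `S` of the polynomial
`z ^ a * (z - 1) ^ b - ν`, where `ν` is the parameter; these roots are distinct. -/
structure IsRootFamily (G : Type*) {S Z : Type*} [CommRing S] [Algebra ℂ[X] S] [Group G]
    [MulSemiringAction G S] [Fintype Z] [MulAction G Z] (a b : ℕ) (ι : Z → S) : Prop where
  injective : Function.Injective ι
  map_smul : ∀ (g : G) (z : Z), ι (g • z) = g • ι z
  prod_eq : ∏ z, (X - C (ι z)) = X ^ a * (X - 1) ^ b - C (param S)

section

theorem smul_constHom {G S : Type*} [CommRing S] [Algebra ℂ[X] S] [Group G] [MulSemiringAction G S]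
    [SMulCommClass G ℂ[X] S] (g : G) (c : ℂ) : g • constHom S c = constHom S c :=
  smul_algebraMap g (C c)

/-- The index of the stabilizer of `y'` divides that of the common stabilizer of `y` and `y'`. -/
theorem card_orbit_dvd_mul_card_orbit_stabilizer {D Y : Type*} [Group D] [MulAction D Y]
    (y y' : Y) :
    (MulAction.orbit D y').ncard ∣
      (MulAction.orbit D y).ncard * (MulAction.orbit (MulAction.stabilizer D y) y').ncard := by
  rw [← MulAction.index_stabilizer, ← MulAction.index_stabilizer, ← MulAction.index_stabilizer]
  have h1 : MulAction.stabilizer (MulAction.stabilizer D y) y' =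
      (MulAction.stabilizer D y').subgroupOf (MulAction.stabilizer D y) := by
    ext g; simp [Subgroup.mem_subgroupOf, MulAction.mem_stabilizer_iff, Subgroup.smul_def]
  rw [h1, mul_comm]
  change _ ∣ (MulAction.stabilizer D y').relIndex (MulAction.stabilizer D y) * _
  rw [← Subgroup.inf_relIndex_right, Subgroup.relIndex_mul_index inf_le_right]
  exact Subgroup.index_dvd_of_le inf_le_left

variable {G S Z : Type*} [CommRing S] [Algebra ℂ[X] S]

variable {ι : Z → S}

/-- The number of members of a family in a given residue class modulo a prime is the multiplicity
of the corresponding root of the reduction of `∏ (X - z)`. -/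
theorem card_residue_eq_rootMultiplicity {Q : Ideal S} [hQ : Q.IsPrime] (s : Finset Z) (f : ℂ[X])
    (hs : (∏ z ∈ s, (X - C (ι z))).map (Ideal.Quotient.mk Q) =
      f.map ((Ideal.Quotient.mk Q).comp (constHom S))) (c : ℂ)
    [DecidablePred fun z => ι z - constHom S c ∈ Q] :
    (s.filter fun z => ι z - constHom S c ∈ Q).card = f.rootMultiplicity c := by
  classical
  rw [eq_rootMultiplicity_map ((Ideal.Quotient.mk Q).comp (constHom S)).injective, ← hs,
    Polynomial.map_prod, ← count_roots]
  have h1 : ∏ z ∈ s, Polynomial.map (Ideal.Quotient.mk Q) (X - C (ι z)) =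
      ((s.val.map fun z => Ideal.Quotient.mk Q (ι z)).map fun x => X - C x).prod := by
    simp only [Polynomial.map_sub, Polynomial.map_X, Polynomial.map_C, Multiset.map_map,
      Function.comp_def, Finset.prod_map_val]
  rw [h1, roots_multiset_prod_X_sub_C, Multiset.count_map, ← Finset.filter_val, ← Finset.card_def]
  congr 1
  refine Finset.filter_congr fun z _ => ?_
  rw [RingHom.comp_apply, eq_comm, Ideal.Quotient.mk_eq_mk_iff_sub_mem]

variable [Group G] [MulSemiringAction G S]

open scoped Pointwise in
/-- Modulo `Q` the decomposition group fixes the residue class of a root. -/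
theorem smul_sub_constHom_mem [SMulCommClass G ℂ[X] S] {Q : Ideal S} {g : G}
    (hg : g ∈ MulAction.stabilizer G Q) {x : S}
    {c : ℂ} (hx : x - constHom S c ∈ Q) : g • x - constHom S c ∈ Q := by
  have h1 : g • (x - constHom S c) ∈ g • Q := Ideal.smul_mem_pointwise_smul_iff.2 hx
  rwa [MulAction.mem_stabilizer_iff.1 hg, smul_sub, smul_constHom] at h1

variable [Fintype Z] [MulAction G Z] {a b : ℕ}

theorem root_equation (h : IsRootFamily G a b ι) (z : Z) :
    ι z ^ a * (ι z - 1) ^ b = param S := by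
  have := congrArg (eval (ι z)) h.prod_eq
  rw [eval_prod, Finset.prod_eq_zero (Finset.mem_univ z) (by simp)] at this
  rw [eval_sub, eq_comm, sub_eq_zero] at this
  simpa using this

theorem eval₂RingHom_equation (h : IsRootFamily G a b ι) (z : Z) :
    eval₂RingHom (constHom S) (ι z) (X ^ a * (X - 1) ^ b) = param S := by
  rw [map_mul, map_pow, map_pow, map_sub, map_one, coe_eval₂RingHom, eval₂_X]
  exact root_equation h z

variable [FaithfulSMul ℂ[X] S]

theorem param_ne_constHom (c : ℂ) : param S ≠ constHom S c := by
  intro h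
  exact X_ne_C c (FaithfulSMul.algebraMap_injective ℂ[X] S h)

theorem root_ne_constHom (h : IsRootFamily G a b ι) (z : Z) (c : ℂ) : ι z ≠ constHom S c := by
  intro hz
  refine param_ne_constHom (S := S) (c ^ a * (c - 1) ^ b) ?_
  rw [← root_equation h z, hz]; simp

/-- A root is congruent, modulo a prime over `ν = ν₀`, to a complex solution of the equation at
`ν₀`. -/
theorem exists_residue (h : IsRootFamily G a b ι) {Q : Ideal S} [hQ : Q.IsPrime] {ν₀ : ℂ}
    (hν : param S - constHom S ν₀ ∈ Q) (z : Z) :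
    ∃ c : ℂ, (X ^ a * (X - 1) ^ b - C ν₀ : ℂ[X]).IsRoot c ∧ ι z - constHom S c ∈ Q := by
  set f : ℂ[X] := X ^ a * (X - 1) ^ b - C ν₀ with hf
  have hfQ : eval₂RingHom (constHom S) (ι z) f ∈ Q := by
    rw [hf, map_sub, eval₂RingHom_equation h]; simpa using hν
  have hf0 : f ≠ 0 := by
    intro h0
    have h1 := congrArg (eval₂RingHom (constHom S) (ι z)) h0
    rw [hf, map_sub, eval₂RingHom_equation h, map_zero, sub_eq_zero] at h1
    exact param_ne_constHom ν₀ (h1.trans (by simp))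
  rw [(IsAlgClosed.splits f).eq_prod_roots, map_mul, hQ.mul_mem_iff_mem_or_mem] at hfQ
  rcases hfQ with hfQ | hfQ
  · exfalso
    apply hQ.ne_top
    refine Ideal.eq_top_of_isUnit_mem _ hfQ ?_
    rw [coe_eval₂RingHom, eval₂_C]
    exact (IsUnit.mk0 _ (leadingCoeff_ne_zero.2 hf0)).map _
  · rw [map_multiset_prod, hQ.multiset_prod_mem_iff_exists_mem] at hfQ
    simp only [Multiset.map_map, Multiset.mem_map] at hfQ
    obtain ⟨_, ⟨c, hc, rfl⟩, hcQ⟩ := hfQ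
    exact ⟨c, isRoot_of_mem_roots hc, by simpa using hcQ⟩

variable [IsDomain S]

/-- The roots are transcendental over `ℂ`. -/
theorem eval₂_constHom_injective (h : IsRootFamily G a b ι) (z : Z) :
    Function.Injective (eval₂RingHom (constHom S) (ι z)) := by
  rw [injective_iff_map_eq_zero]
  intro f hf
  by_contra hf0
  rw [(IsAlgClosed.splits f).eq_prod_roots, map_mul, map_multiset_prod, mul_eq_zero,
    Multiset.prod_eq_zero_iff] at hf
  rcases hf with hf | hf
  · rw [coe_eval₂RingHom, eval₂_C, constHom, RingHom.comp_apply,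
      FaithfulSMul.algebraMap_eq_zero_iff, C_eq_zero, leadingCoeff_eq_zero] at hf
    exact hf0 hf
  · simp only [Multiset.map_map, Multiset.mem_map] at hf
    obtain ⟨c, -, hc⟩ := hf
    refine root_ne_constHom h z c ?_
    simpa [sub_eq_zero] using hc

/-- The group acts transitively on the roots: since a root `z` is transcendental over `ℂ` and
`ν = z ^ a * (z - 1) ^ b`, the polynomial relations between `ν` and `z` are the same for all
roots. -/
theorem exists_smul_eq_of_isRootFamily [Finite G] [Algebra.IsInvariant ℂ[X] S G]
    (h : IsRootFamily G a b ι) (z z' : Z) :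
    ∃ g : G, g • z = z' := by
  classical
  cases nonempty_fintype G
  obtain ⟨M, hM⟩ := (mem_lifts _).1 (Algebra.IsInvariant.charpoly_mem_lifts ℂ[X] S G (ι z))
  have key : ∀ y : Z, eval₂RingHom (constHom S) (ι y)
      (eval₂ (compRingHom (X ^ a * (X - 1) ^ b)) X M) =
        (MulSemiringAction.charpoly G (ι z)).eval (ι y) := by
    intro y
    have hcomp : (eval₂RingHom (constHom S) (ι y)).comp (compRingHom (X ^ a * (X - 1) ^ b)) =
        algebraMap ℂ[X] S := by
      refine ringHom_ext (fun c => by simp [constHom]) ?_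
      rw [RingHom.comp_apply, coe_compRingHom_apply, X_comp]
      exact eval₂RingHom_equation h y
    rw [hom_eval₂, hcomp, ← hM, eval_map]
    simp
  have h0 : eval₂ (compRingHom (X ^ a * (X - 1) ^ b)) X M = 0 := by
    apply eval₂_constHom_injective h z
    rw [key, MulSemiringAction.eval_charpoly, map_zero]
  have h1 := key z'
  rw [h0, map_zero, MulSemiringAction.charpoly_eq, eval_prod, eq_comm,
    Finset.prod_eq_zero_iff] at h1
  obtain ⟨g, -, hg⟩ := h1
  refine ⟨g, h.injective ?_⟩
  rw [h.map_smul]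
  simpa [sub_eq_zero, eq_comm] using hg

end

open scoped Pointwise in
/-- If `u y` has order `e / k` at `Q`, where `e` is the order of the base prime, for each `y` in an
orbit of the decomposition group, then `k` divides the size of that orbit. -/
theorem dvd_card_orbit_of_primeOrd {G S Z : Type*} [CommRing S] [IsDedekindDomain S]
    [Algebra ℂ[X] S] [FaithfulSMul ℂ[X] S] [Group G] [Finite G] [MulSemiringAction G S]
    [Algebra.IsInvariant ℂ[X] S G] [Fintype Z] [MulAction G Z]
    {π : ℂ[X]} (hπ : Prime π) {Q : Ideal S} [hQ : Q.IsPrime]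
    (hπQ : algebraMap ℂ[X] S π ∈ Q) (u : Z → S) (hu0 : ∀ y, u y ≠ 0)
    (hu : ∀ (g : G) (y : Z), u (g • y) = g • u y) (k : ℕ) (z : Z)
    (hk : ∀ y ∈ MulAction.orbit (MulAction.stabilizer G Q) z,
      k * primeOrd Q (u y) = primeOrd Q (algebraMap ℂ[X] S π)) :
    k ∣ (MulAction.orbit (MulAction.stabilizer G Q) z).ncard := by
  classical
  have hπ0 : algebraMap ℂ[X] S π ≠ 0 := by simpa using hπ.ne_zero
  have h0 : Q ≠ ⊥ := fun h => hπ0 (by simpa [h] using hπQ)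
  have hpos : 0 < primeOrd Q (algebraMap ℂ[X] S π) := (primeOrd_pos_iff h0 hπ0).2 hπQ
  set O := (MulAction.orbit (MulAction.stabilizer G Q) z).toFinset with hO
  have hdvd := primeOrd_dvd_of_stabilizer_fixed (G := G) hπ hπQ (θ := ∏ y ∈ O, u y)
    (Finset.prod_ne_zero_iff.2 fun y _ => hu0 y) (fun g hg => by
      rw [Finset.smul_prod']
      refine Finset.prod_bij (fun y _ => g • y) (fun y hy => ?_)
        (fun y _ y' _ hyy => by simpa using hyy)
        (fun y hy => ⟨g⁻¹ • y, ?_, by simp⟩) (fun y _ => (hu g y).symm)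
      · rw [hO, Set.mem_toFinset] at hy ⊢
        exact MulAction.mem_orbit_of_mem_orbit (⟨g, hg⟩ : MulAction.stabilizer G Q) hy
      · rw [hO, Set.mem_toFinset] at hy ⊢
        exact MulAction.mem_orbit_of_mem_orbit (⟨g, hg⟩⁻¹ : MulAction.stabilizer G Q) hy)
  rw [primeOrd_prod h0 _ _ fun y _ => hu0 y] at hdvd
  have hmul : k * ∑ y ∈ O, primeOrd Q (u y) = O.card * primeOrd Q (algebraMap ℂ[X] S π) := by
    rw [Finset.mul_sum, Finset.sum_congr rfl fun y hy => hk y (by simpa [hO] using hy)]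
    simp
  obtain ⟨j, hj⟩ := hdvd
  rw [hj, mul_left_comm, mul_comm O.card] at hmul
  rw [Set.ncard_eq_toFinset_card']
  exact ⟨j, (Nat.eq_of_mul_eq_mul_left hpos hmul).symm⟩

/-! ### A transposition over the critical value -/

theorem exists_prime_over_point {G : Type*} (S : Type*) [CommRing S] [Algebra ℂ[X] S]
    [FaithfulSMul ℂ[X] S] [Group G] [Finite G] [MulSemiringAction G S]
    [Algebra.IsInvariant ℂ[X] S G] (ν₀ : ℂ) :
    ∃ Q : Ideal S, Q.IsPrime ∧ param S - constHom S ν₀ ∈ Q := by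
  have : Algebra.IsIntegral ℂ[X] S := Algebra.IsInvariant.isIntegral ℂ[X] S G
  have hmax : (Ideal.span {X - C ν₀} : Ideal ℂ[X]).IsMaximal :=
    PrincipalIdealRing.isMaximal_of_irreducible (prime_X_sub_C ν₀).irreducible
  obtain ⟨Q, hQ, hQc⟩ := Ideal.exists_ideal_over_maximal_of_isIntegral (S := S)
    (Ideal.span {X - C ν₀} : Ideal ℂ[X]) (by
      rw [(RingHom.injective_iff_ker_eq_bot _).1 (FaithfulSMul.algebraMap_injective ℂ[X] S)]
      exact bot_le)
  refine ⟨Q, hQ.isPrime, ?_⟩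
  have h1 : (X - C ν₀ : ℂ[X]) ∈ Ideal.comap (algebraMap ℂ[X] S) Q := by
    rw [hQc]; exact Ideal.mem_span_singleton_self _
  simpa [param, constHom] using h1

/-- The critical value of `z ^ a * (z - 1) ^ b` at `z = a / (a + b)` is taken there twice, and it
is taken once at each other point. -/
theorem rootMultiplicity_critical {a b : ℕ} (ha : 0 < a) (hb : 0 < b) {c₀ ν₀ : ℂ}
    (hc₀ : c₀ = a / (a + b : ℂ)) (hν₀ : ν₀ = c₀ ^ a * (c₀ - 1) ^ b) {c : ℂ}
    (hc : (X ^ a * (X - 1) ^ b - C ν₀ : ℂ[X]).IsRoot c) :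
    (X ^ a * (X - 1) ^ b - C ν₀ : ℂ[X]).rootMultiplicity c = if c = c₀ then 2 else 1 := by
  obtain ⟨a', rfl⟩ : ∃ k, a = k + 1 := ⟨a - 1, by omega⟩
  obtain ⟨b', rfl⟩ : ∃ k, b = k + 1 := ⟨b - 1, by omega⟩
  have hab : ((a' + 1 : ℕ) + (b' + 1 : ℕ) : ℂ) ≠ 0 := by norm_cast
  have hcc : ((a' + 1 : ℕ) + (b' + 1 : ℕ) : ℂ) * c₀ = (a' + 1 : ℕ) := by
    rw [hc₀]; field_simp
  have hc₀0 : c₀ ≠ 0 := by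
    rw [hc₀]; exact div_ne_zero (by norm_cast) hab
  have hc₀1 : c₀ - 1 ≠ 0 := by
    intro h
    rw [sub_eq_zero] at h
    rw [h] at hcc
    have : ((b' + 1 : ℕ) : ℂ) = 0 := by linear_combination hcc
    norm_cast at this
  have hν0 : ν₀ ≠ 0 := by
    rw [hν₀]; exact mul_ne_zero (pow_ne_zero _ hc₀0) (pow_ne_zero _ hc₀1)
  have hcν : c ^ (a' + 1) * (c - 1) ^ (b' + 1) = ν₀ := by
    simpa [sub_eq_zero] using hc
  have hcne : c ≠ 0 := by rintro rfl; apply hν0; rw [← hcν]; simp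
  have hcne1 : c - 1 ≠ 0 := by intro h; apply hν0; rw [← hcν, h]; simp
  -- The critical points are among `0`, `1` and `c₀`; neither `0` nor `1` has the value `ν₀ ≠ 0`.
  have hder : derivative (X ^ (a' + 1) * (X - 1) ^ (b' + 1) - C ν₀ : ℂ[X]) =
      (C ((a' + 1 : ℕ) + (b' + 1 : ℕ) : ℂ) * (X ^ a' * (X - 1) ^ b')) * (X - C c₀) := by
    have h1 : (C ((a' + 1 : ℕ) + (b' + 1 : ℕ) : ℂ) : ℂ[X]) * C c₀ = C ((a' + 1 : ℕ) : ℂ) := by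
      rw [← C_mul, hcc]
    have h2 : derivative (X - 1 : ℂ[X]) = 1 := by simp
    rw [derivative_sub, derivative_mul, derivative_X_pow, derivative_pow, h2, derivative_C,
      Nat.add_sub_cancel, Nat.add_sub_cancel]
    have h3 : (C ((b' + 1 : ℕ) : ℂ) : ℂ[X]) =
      C ((a' + 1 : ℕ) + (b' + 1 : ℕ) : ℂ) - C ((a' + 1 : ℕ) : ℂ) := by
      rw [← C_sub]; congr 1; ring
    rw [h3, ← h1]; ring
  have hg : rootMultiplicity c
      (C ((a' + 1 : ℕ) + (b' + 1 : ℕ) : ℂ) * (X ^ a' * (X - 1) ^ b')) = 0 := by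
    refine rootMultiplicity_eq_zero ?_
    simp only [IsRoot, eval_mul, eval_C, eval_pow, eval_X, eval_sub, eval_one]
    exact mul_ne_zero hab (mul_ne_zero (pow_ne_zero _ hcne) (pow_ne_zero _ hcne1))
  have hX1 : (X - 1 : ℂ[X]) ≠ 0 := X_sub_C_ne_zero 1
  have hne : (C ((a' + 1 : ℕ) + (b' + 1 : ℕ) : ℂ) * (X ^ a' * (X - 1) ^ b')) * (X - C c₀) ≠ 0 :=
    mul_ne_zero (mul_ne_zero (C_ne_zero.2 hab)
      (mul_ne_zero (pow_ne_zero _ X_ne_zero) (pow_ne_zero _ hX1))) (X_sub_C_ne_zero c₀)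
  have h4 := derivative_rootMultiplicity_of_root hc
  rw [hder, rootMultiplicity_mul hne, hg, rootMultiplicity_X_sub_C] at h4
  have hf0 : (X ^ (a' + 1) * (X - 1) ^ (b' + 1) - C ν₀ : ℂ[X]) ≠ 0 := by
    intro h; rw [h, derivative_zero] at hder; exact hne hder.symm
  have h5 := (rootMultiplicity_pos hf0).2 hc
  split_ifs at h4 ⊢ <;> omega

open scoped Pointwise in
/-- Over the critical value `ν₀` of `z ^ a * (z - 1) ^ b` exactly two roots meet.  The decomposition
group fixes the other roots, and it moves these two since their distances to the critical point
have orders adding up to the order of `ν - ν₀`. -/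
theorem exists_swap_mem_range {G S Z : Type*} [CommRing S] [IsDedekindDomain S] [Algebra ℂ[X] S]
    [FaithfulSMul ℂ[X] S] [Group G] [Finite G] [MulSemiringAction G S] [SMulCommClass G ℂ[X] S]
    [Algebra.IsInvariant ℂ[X] S G] [Fintype Z] [DecidableEq Z] [MulAction G Z] {a b : ℕ}
    {ι : Z → S} (h : IsRootFamily G a b ι) (ha : 0 < a) (hb : 0 < b) :
    ∃ z₁ z₂ : Z, z₁ ≠ z₂ ∧ Equiv.swap z₁ z₂ ∈ (MulAction.toPermHom G Z).range := by
  classical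
  set c₀ : ℂ := a / (a + b : ℂ) with hc₀
  set ν₀ : ℂ := c₀ ^ a * (c₀ - 1) ^ b with hν₀
  obtain ⟨Q, hQ, hνQ⟩ := exists_prime_over_point (G := G) S ν₀
  have hcard : ∀ c : ℂ, (X ^ a * (X - 1) ^ b - C ν₀ : ℂ[X]).IsRoot c →
      (Finset.univ.filter fun z => ι z - constHom S c ∈ Q).card = if c = c₀ then 2 else 1 := by
    intro c hc
    rw [← rootMultiplicity_critical ha hb hc₀ hν₀ hc]
    refine card_residue_eq_rootMultiplicity _ _ ?_ c
    rw [h.prod_eq]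
    have h1 : Ideal.Quotient.mk Q (param S) = Ideal.Quotient.mk Q (constHom S ν₀) :=
      (Ideal.Quotient.mk_eq_mk_iff_sub_mem _ _).2 hνQ
    simp [h1]
  have hroot₀ : (X ^ a * (X - 1) ^ b - C ν₀ : ℂ[X]).IsRoot c₀ := by simp [hν₀]
  obtain ⟨z₁, z₂, hne, hpair⟩ := Finset.card_eq_two.1 ((hcard c₀ hroot₀).trans (if_pos rfl))
  have hmem : ∀ z, ι z - constHom S c₀ ∈ Q ↔ z = z₁ ∨ z = z₂ := fun z => by
    simpa using Finset.ext_iff.1 hpair z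
  have hfix : ∀ g ∈ MulAction.stabilizer G Q, ∀ z, z ≠ z₁ → z ≠ z₂ → g • z = z := by
    intro g hg z hz1 hz2
    obtain ⟨c, hc, hcQ⟩ := exists_residue h hνQ z
    have hcc : c ≠ c₀ := by
      rintro rfl; exact ((hmem z).1 hcQ).elim hz1 hz2
    obtain ⟨y, hy⟩ := Finset.card_eq_one.1 ((hcard c hc).trans (if_neg hcc))
    have h1 : z = y := by simpa [hcQ] using Finset.ext_iff.1 hy z
    have h2 : g • z = y := by
      simpa [h.map_smul, smul_sub_constHom_mem hg hcQ] using Finset.ext_iff.1 hy (g • z)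
    rw [h1] at h2 ⊢; exact h2
  -- Were `z₁` fixed, the order of `c₀ - z₁` would be a multiple of the order of `ν₀ - ν`; but it is
  -- smaller, as the orders of `c₀ - z₁` and `c₀ - z₂` are positive and add up to that order.
  have hmove : ∃ g ∈ MulAction.stabilizer G Q, g • z₁ ≠ z₁ := by
    by_contra! hno
    set π : ℂ[X] := C ν₀ - X with hπdef
    have hπ : Prime π := by
      rw [hπdef, ← neg_sub]; exact (prime_X_sub_C ν₀).neg
    have hπS : algebraMap ℂ[X] S π = constHom S ν₀ - param S := by
      simp [hπdef, constHom, param]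
    have hπQ : algebraMap ℂ[X] S π ∈ Q := by
      rw [hπS, ← neg_sub]; exact neg_mem hνQ
    have hπ0 : algebraMap ℂ[X] S π ≠ 0 := by simpa using hπ.ne_zero
    have h0 : Q ≠ ⊥ := fun h => hπ0 (by simpa [h] using hπQ)
    have hu0 : ∀ z, constHom S c₀ - ι z ≠ 0 := fun z =>
      sub_ne_zero.2 (root_ne_constHom h z c₀).symm
    have huQ : ∀ z, constHom S c₀ - ι z ∈ Q ↔ z = z₁ ∨ z = z₂ := fun z => by
      rw [← hmem, ← neg_sub, neg_mem_iff]
    have hprod : ∏ z, (constHom S c₀ - ι z) = algebraMap ℂ[X] S π := by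
      have := congrArg (eval (constHom S c₀)) h.prod_eq
      rw [eval_prod] at this
      simpa [hπS, hν₀] using this
    have hord := congrArg (primeOrd Q) hprod
    rw [primeOrd_prod h0 _ _ fun z _ => hu0 z, ← Finset.sum_subset (Finset.subset_univ {z₁, z₂})
      (fun z _ hz => primeOrd_eq_zero h0 (by rw [huQ]; simpa using hz)),
      Finset.sum_pair hne] at hord
    have hp1 := (primeOrd_pos_iff h0 (hu0 z₁)).2 ((huQ z₁).2 (Or.inl rfl))
    have hp2 := (primeOrd_pos_iff h0 (hu0 z₂)).2 ((huQ z₂).2 (Or.inr rfl))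
    have hdvd := Nat.le_of_dvd hp1 (primeOrd_dvd_of_stabilizer_fixed (G := G) hπ hπQ (hu0 z₁)
      fun g hg => by rw [smul_sub, smul_constHom, ← h.map_smul, hno g hg])
    omega
  obtain ⟨g, hg, hg1⟩ := hmove
  have hg1' : g • z₁ = z₂ := by
    refine ((hmem _).1 ?_).resolve_left hg1
    rw [h.map_smul]; exact smul_sub_constHom_mem hg ((hmem z₁).2 (Or.inl rfl))
  have hg2' : g • z₂ = z₁ := by
    refine ((hmem _).1 ?_).resolve_right fun h2 => hne ?_
    · rw [h.map_smul]; exact smul_sub_constHom_mem hg ((hmem z₂).2 (Or.inr rfl))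
    · exact MulAction.injective g (hg1'.trans h2.symm)
  refine ⟨z₁, z₂, hne, g, Equiv.ext fun y => ?_⟩
  rw [MulAction.toPermHom_apply, MulAction.toPerm_apply]
  by_cases h1 : y = z₁
  · rw [h1, hg1', Equiv.swap_apply_left]
  by_cases h2 : y = z₂
  · rw [h2, hg2', Equiv.swap_apply_right]
  rw [Equiv.swap_apply_of_ne_of_ne h1 h2, hfix g hg y h1 h2]

/-! ### Classes of points exchanged by transpositions -/

/-- The points `y` for which the transposition of `z` and `y` lies in `H`, together with `z`.  These
sets form a partition. -/
noncomputable def swapClass {Z : Type*} [Fintype Z] [DecidableEq Z] (H : Subgroup (Equiv.Perm Z))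
    (z : Z) : Finset Z :=
  open scoped Classical in Finset.univ.filter fun y => Equiv.swap z y ∈ H

section SwapClass

variable {Z : Type*} [Fintype Z] [DecidableEq Z] {H : Subgroup (Equiv.Perm Z)}

theorem mem_swapClass {z y : Z} : y ∈ swapClass H z ↔ Equiv.swap z y ∈ H := by
  simp [swapClass]

theorem self_mem_swapClass (z : Z) : z ∈ swapClass H z := by
  rw [mem_swapClass, Equiv.swap_self]; exact H.one_mem

theorem swapClass_eq_iff {z y : Z} : swapClass H y = swapClass H z ↔ y ∈ swapClass H z := by
  constructor
  · intro h; rw [← h]; exact self_mem_swapClass y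
  · intro h
    rw [mem_swapClass] at h
    ext w
    rw [mem_swapClass, mem_swapClass]
    exact ⟨SubmonoidClass.swap_mem_trans H h,
      SubmonoidClass.swap_mem_trans H (by rwa [Equiv.swap_comm])⟩

theorem swapClass_apply {π : Equiv.Perm Z} (hπ : π ∈ H) (z : Z) :
    swapClass H (π z) = (swapClass H z).map π.toEmbedding := by
  ext y
  rw [mem_swapClass, Finset.mem_map_equiv, mem_swapClass]
  have h1 : Equiv.swap (π z) y = π * Equiv.swap z (π.symm y) * π⁻¹ := by
    rw [← Equiv.swap_apply_apply, Equiv.apply_symm_apply]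
  rw [h1, Subgroup.mul_mem_cancel_right _ (H.inv_mem hπ), Subgroup.mul_mem_cancel_left _ hπ]

/-- A union of classes of size `k` has size divisible by `k`. -/
theorem dvd_card_of_swapClass_subset {T : Finset Z} {k : ℕ} (hT : ∀ y ∈ T, swapClass H y ⊆ T)
    (hk : ∀ y ∈ T, (swapClass H y).card = k) : k ∣ T.card := by
  rw [Finset.card_eq_sum_card_image (swapClass H) T]
  refine Finset.dvd_sum fun c hc => ?_
  obtain ⟨y, hy, rfl⟩ := Finset.mem_image.1 hc
  have h1 : (T.filter fun z => swapClass H z = swapClass H y) = swapClass H y := by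
    ext z
    rw [Finset.mem_filter, swapClass_eq_iff]
    exact ⟨fun h => h.2, fun h => ⟨hT y hy h, h⟩⟩
  rw [h1, hk y hy]

end SwapClass

/-! ### Blocks of roots -/

/-- A monic divisor of a product of distinct linear factors is the product of those that vanish at
its roots. -/
theorem eq_prod_filter_of_monic_of_dvd {S Z : Type*} [CommRing S] [IsDomain S] [Fintype Z]
    {ι : Z → S} (hι : Function.Injective ι) {f : S[X]} (hf : f.Monic)
    (hdvd : f ∣ ∏ z, (X - C (ι z))) [DecidablePred fun z => f.eval (ι z) = 0] :
    ∏ z with f.eval (ι z) = 0, (X - C (ι z)) = f := by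
  classical
  have hprod : ∏ z, (X - C (ι z)) = ((Finset.univ.val.map ι).map fun x => X - C x).prod := by
    rw [Multiset.map_map]; rfl
  have h0 : ∏ z, (X - C (ι z)) ≠ 0 := Finset.prod_ne_zero_iff.2 fun z _ => X_sub_C_ne_zero _
  have hle : f.roots ≤ Finset.univ.val.map ι := by
    rw [← roots_multiset_prod_X_sub_C (Finset.univ.val.map ι), ← hprod]
    exact roots.le_of_dvd h0 hdvd
  have hnd : (Finset.univ.val.map ι).Nodup := Finset.univ.nodup.map hι
  have hroots : f.roots = (Finset.univ.filter fun z => f.eval (ι z) = 0).val.map ι := by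
    rw [Multiset.Nodup.ext (Multiset.nodup_of_le hle hnd)
      ((Finset.nodup _).map hι)]
    intro x
    constructor
    · intro hx
      obtain ⟨z, -, rfl⟩ := Multiset.mem_map.1 (Multiset.mem_of_le hle hx)
      refine Multiset.mem_map_of_mem ι ?_
      simpa using (mem_roots hf.ne_zero).1 hx
    · intro hx
      obtain ⟨z, hz, rfl⟩ := Multiset.mem_map.1 hx
      rw [mem_roots hf.ne_zero]
      simpa using hz
  have hs : f.Splits := Splits.of_dvd (Splits.prod fun z _ => Splits.X_sub_C _) h0 hdvd
  conv_rhs => rw [hs.eq_prod_roots_of_monic hf, hroots, Multiset.map_map]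
  rfl

section

variable {G S Z : Type*} [CommRing S] [Algebra ℂ[X] S] [Group G] [MulSemiringAction G S]
  [Fintype Z] [MulAction G Z] {a b t : ℕ} {ι : Z → S}

theorem blockValue_pow (h : IsRootFamily G (t * a) (t * b) ι) (z : Z) :
    (ι z ^ a * (ι z - 1) ^ b) ^ t = param S := by
  rw [← root_equation h z, mul_pow, ← pow_mul, ← pow_mul, mul_comm a, mul_comm b]

theorem smul_blockValue (h : IsRootFamily G (t * a) (t * b) ι) (g : G) (z : Z) :
    ι (g • z) ^ a * (ι (g • z) - 1) ^ b = g • (ι z ^ a * (ι z - 1) ^ b) := by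
  rw [h.map_smul, smul_mul', smul_pow', smul_pow', smul_sub, smul_one]

variable (S) in
omit [Algebra ℂ[X] S] in
theorem monic_shape (a b : ℕ) : (X ^ a * (X - 1) ^ b : S[X]).Monic := by
  simpa using (monic_X_pow a).mul ((monic_X_sub_C (1 : S)).pow b)

variable (S) in
omit [Algebra ℂ[X] S] in
theorem natDegree_shape [Nontrivial S] (a b : ℕ) :
    (X ^ a * (X - 1) ^ b : S[X]).natDegree = a + b := by
  have h1 : (X - 1 : S[X]) = X - C 1 := by simp
  rw [h1, (monic_X_pow a).natDegree_mul ((monic_X_sub_C (1 : S)).pow b), natDegree_X_pow,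
    (monic_X_sub_C (1 : S)).natDegree_pow, natDegree_X_sub_C, mul_one]

variable (S) in
omit [Algebra ℂ[X] S] in
theorem monic_shape_sub_C [Nontrivial S] {a : ℕ} (ha : 0 < a) (b : ℕ) (w : S) :
    (X ^ a * (X - 1) ^ b - C w : S[X]).Monic := by
  refine (monic_shape S a b).sub_of_left (lt_of_le_of_lt degree_C_le ?_)
  rw [← natDegree_pos_iff_degree_pos, natDegree_shape]; omega

/-- The roots in the block of `z` are the roots of `X ^ a * (X - 1) ^ b - w`, where `w` is the value
at `z`. -/
theorem prod_block_eq [IsDomain S] (h : IsRootFamily G (t * a) (t * b) ι) (ha : 0 < a) (z : Z)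
    [DecidablePred fun y => ι y ^ a * (ι y - 1) ^ b = ι z ^ a * (ι z - 1) ^ b] :
    ∏ y with ι y ^ a * (ι y - 1) ^ b = ι z ^ a * (ι z - 1) ^ b, (X - C (ι y)) =
      X ^ a * (X - 1) ^ b - C (ι z ^ a * (ι z - 1) ^ b) := by
  classical
  set w := ι z ^ a * (ι z - 1) ^ b with hw
  have hdvd : X ^ a * (X - 1) ^ b - C w ∣ ∏ y, (X - C (ι y)) := by
    rw [h.prod_eq, ← blockValue_pow h z, ← hw, C_pow]
    have h1 : (X ^ (t * a) * (X - 1) ^ (t * b) : S[X]) = (X ^ a * (X - 1) ^ b) ^ t := by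
      rw [mul_pow, ← pow_mul, ← pow_mul, mul_comm a, mul_comm b]
    rw [h1]
    exact sub_dvd_pow_sub_pow _ _ t
  rw [← eq_prod_filter_of_monic_of_dvd h.injective (monic_shape_sub_C S ha b w) hdvd]
  refine Finset.prod_congr (Finset.ext fun y => ?_) fun _ _ => rfl
  simp [sub_eq_zero, hw]

theorem card_block_eq [IsDomain S] (h : IsRootFamily G (t * a) (t * b) ι) (ha : 0 < a) (z : Z)
    [DecidablePred fun y => ι y ^ a * (ι y - 1) ^ b = ι z ^ a * (ι z - 1) ^ b] :
    (Finset.univ.filter fun y =>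
      ι y ^ a * (ι y - 1) ^ b = ι z ^ a * (ι z - 1) ^ b).card = a + b := by
  have h1 := congrArg natDegree (prod_block_eq h ha z)
  rw [natDegree_sub_C, natDegree_shape, natDegree_prod_of_monic _ _ fun y _ => monic_X_sub_C _]
    at h1
  simpa using h1

theorem rootMultiplicity_shape_zero (a b : ℕ) :
    (X ^ a * (X - 1) ^ b : ℂ[X]).rootMultiplicity 0 = a := by
  have h1 : (X : ℂ[X]) ^ a = (X - C 0) ^ a := by simp
  rw [rootMultiplicity_mul (monic_shape ℂ a b).ne_zero, h1, rootMultiplicity_X_sub_C_pow,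
    rootMultiplicity_eq_zero, add_zero]
  simp [IsRoot]

theorem rootMultiplicity_shape_one (a b : ℕ) :
    (X ^ a * (X - 1) ^ b : ℂ[X]).rootMultiplicity 1 = b := by
  have h1 : (X - 1 : ℂ[X]) ^ b = (X - C 1) ^ b := by simp
  rw [rootMultiplicity_mul (monic_shape ℂ a b).ne_zero, h1, rootMultiplicity_X_sub_C_pow,
    rootMultiplicity_eq_zero, zero_add]
  simp [IsRoot]

end

/-! ### All transpositions inside a block -/

section Primitive

variable {G S Z : Type*} [CommRing S] [IsDedekindDomain S] [Algebra ℂ[X] S] [FaithfulSMul ℂ[X] S]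
  [Group G] [Finite G] [MulSemiringAction G S] [SMulCommClass G ℂ[X] S]
  [Algebra.IsInvariant ℂ[X] S G] [Fintype Z] [DecidableEq Z] [MulAction G Z]
  {ι : Z → S}

omit [DecidableEq Z] in
open scoped Pointwise in
/-- At a prime over `ν = 0` the decomposition group permutes transitively the roots that reduce to
`0`, and also those that reduce to `1`. -/
theorem ncard_orbit_stabilizer {a b : ℕ} (h : IsRootFamily G a b ι) {Q : Ideal S} [hQ : Q.IsPrime]
    (hνQ : param S ∈ Q) (z : Z) :
    (ι z ∈ Q → (MulAction.orbit (MulAction.stabilizer G Q) z).ncard = a) ∧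
    (ι z - 1 ∈ Q → (MulAction.orbit (MulAction.stabilizer G Q) z).ncard = b) := by
  classical
  have hparam : param S ≠ 0 := by simpa using param_ne_constHom (S := S) 0
  have h0 : Q ≠ ⊥ := fun h => hparam (by simpa [h] using hνQ)
  have hι0 : ∀ y, ι y ≠ 0 := fun y => by simpa using root_ne_constHom h y 0
  have hι1 : ∀ y, ι y - 1 ≠ 0 := fun y => sub_ne_zero.2 (by simpa using root_ne_constHom h y 1)
  have hnot : ∀ y, ι y ∈ Q → ι y - 1 ∉ Q := fun y h1 h2 => hQ.ne_top
    ((Ideal.eq_top_iff_one Q).2 (by simpa using Ideal.sub_mem _ h1 h2))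
  have hord : ∀ y, a * primeOrd Q (ι y) + b * primeOrd Q (ι y - 1) = primeOrd Q (param S) := by
    intro y
    rw [← root_equation h y, primeOrd_mul h0 (pow_ne_zero _ (hι0 y)) (pow_ne_zero _ (hι1 y)),
      primeOrd_pow h0 (hι0 y), primeOrd_pow h0 (hι1 y)]
  have hcard : ∀ c : ℂ, (Finset.univ.filter fun z => ι z - constHom S c ∈ Q).card =
      (X ^ a * (X - 1) ^ b : ℂ[X]).rootMultiplicity c := fun c =>
    card_residue_eq_rootMultiplicity _ _ (by
      rw [h.prod_eq]; simp [Ideal.Quotient.eq_zero_iff_mem.2 hνQ]) c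
  have hsub : ∀ c : ℂ, ι z - constHom S c ∈ Q → ∀ y ∈ MulAction.orbit (MulAction.stabilizer G Q) z,
      ι y - constHom S c ∈ Q := by
    rintro c hc _ ⟨g, rfl⟩
    change ι ((g : G) • z) - _ ∈ Q
    rw [h.map_smul]
    exact smul_sub_constHom_mem g.2 hc
  have hle : ∀ c : ℂ, ι z - constHom S c ∈ Q →
      (MulAction.orbit (MulAction.stabilizer G Q) z).ncard ≤
        (X ^ a * (X - 1) ^ b : ℂ[X]).rootMultiplicity c := by
    intro c hc
    rw [← hcard c, ← Set.ncard_coe_finset]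
    exact Set.ncard_le_ncard (fun y hy => by simpa using hsub c hc y hy)
  have hpos : 0 < (MulAction.orbit (MulAction.stabilizer G Q) z).ncard :=
    (Set.ncard_pos).2 (MulAction.nonempty_orbit z)
  constructor
  · intro hz
    have hz' : ι z - constHom S 0 ∈ Q := by simpa using hz
    refine le_antisymm ((hle 0 hz').trans_eq (rootMultiplicity_shape_zero a b))
      (Nat.le_of_dvd hpos (dvd_card_orbit_of_primeOrd prime_X hνQ ι hι0 h.map_smul a z ?_))
    intro y hy
    have hy0 : ι y ∈ Q := by simpa using hsub 0 hz' y hy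
    have := hord y
    rwa [primeOrd_eq_zero h0 (hnot y hy0), mul_zero, add_zero] at this
  · intro hz
    have hz' : ι z - constHom S 1 ∈ Q := by simpa using hz
    refine le_antisymm ((hle 1 hz').trans_eq (rootMultiplicity_shape_one a b))
      (Nat.le_of_dvd hpos (dvd_card_orbit_of_primeOrd prime_X hνQ (fun y => ι y - 1) hι1
        (fun g y => by rw [h.map_smul, smul_sub, smul_one]) b z ?_))
    intro y hy
    have hy0 : ι y - 1 ∈ Q := by simpa using hsub 1 hz' y hy
    have := hord y
    rwa [primeOrd_eq_zero h0 (fun h2 => hnot y h2 hy0), mul_zero, zero_add] at this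

omit [FaithfulSMul ℂ[X] S] [Finite G] [SMulCommClass G ℂ[X] S]
  [Algebra.IsInvariant ℂ[X] S G] in
/-- A transposition in the image of the group exchanges two roots of the same block. -/
theorem blockValue_eq_of_swap_mem {a b t : ℕ} (h : IsRootFamily G (t * a) (t * b) ι) (ha : 0 < a)
    (hb : 0 < b) {z z' : Z} (hs : Equiv.swap z z' ∈ (MulAction.toPermHom G Z).range) :
    ι z' ^ a * (ι z' - 1) ^ b = ι z ^ a * (ι z - 1) ^ b := by
  classical
  obtain ⟨g, hg⟩ := hs
  have hg' : ∀ y, g • y = Equiv.swap z z' y := fun y => by rw [← hg]; rfl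
  -- Another root `y` of the block of `z` is either `z'` or fixed by the transposition.
  obtain ⟨y, hy, hyz⟩ := Finset.exists_mem_ne
    (lt_of_lt_of_eq (show 1 < a + b by omega) (card_block_eq h ha z).symm) z
  rw [Finset.mem_filter] at hy
  by_cases hyz' : y = z'
  · rw [← hyz']; exact hy.2
  · have h1 : g • y = y := by rw [hg', Equiv.swap_apply_of_ne_of_ne hyz hyz']
    have h2 : g • z = z' := by rw [hg', Equiv.swap_apply_left]
    rw [← h2, smul_blockValue h, ← hy.2, ← smul_blockValue h, h1]

open scoped Pointwise in
/-- The image of the group contains the transposition of any two roots of the same block. -/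
theorem swap_mem_range_of_blockValue_eq {a b t : ℕ} (h : IsRootFamily G (t * a) (t * b) ι)
    (ht : 0 < t) (ha : 0 < a) (hb : 0 < b) (hab : a.Coprime b) {z z' : Z}
    (hzz : ι z' ^ a * (ι z' - 1) ^ b = ι z ^ a * (ι z - 1) ^ b) :
    Equiv.swap z z' ∈ (MulAction.toPermHom G Z).range := by
  classical
  set H := (MulAction.toPermHom G Z).range with hH
  let block : Z → Finset Z := fun z => Finset.univ.filter fun y =>
    ι y ^ a * (ι y - 1) ^ b = ι z ^ a * (ι z - 1) ^ b
  have hblock : ∀ y, (block y).card = a + b := fun y => card_block_eq h ha y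
  have hsub : ∀ y, swapClass H y ⊆ block y := fun y x hx => by
    rw [mem_swapClass] at hx
    simpa [block] using blockValue_eq_of_swap_mem h ha hb hx
  have hconst : ∀ y y', (swapClass H y).card = (swapClass H y').card := by
    intro y y'
    obtain ⟨g, rfl⟩ := exists_smul_eq_of_isRootFamily h y y'
    have h1 := swapClass_apply (H := H) (π := MulAction.toPermHom G Z g) ⟨g, rfl⟩ y
    rw [MulAction.toPermHom_apply, MulAction.toPerm_apply] at h1
    rw [h1, Finset.card_map]
  suffices hex : ∃ y, a + b ≤ (swapClass H y).card by
    obtain ⟨y, hy⟩ := hex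
    have h1 : swapClass H z = block z :=
      Finset.eq_of_subset_of_card_le (hsub z) (by rw [hblock, hconst z y]; exact hy)
    rw [← mem_swapClass, h1]
    simpa [block] using hzz
  obtain ⟨Q, hQ, hνQ⟩ := exists_prime_over_point (G := G) S 0
  rw [map_zero, sub_zero] at hνQ
  have hnot : ∀ y, ι y ∈ Q → ι y - 1 ∉ Q := fun y h1 h2 => hQ.ne_top
    ((Ideal.eq_top_iff_one Q).2 (by simpa using Ideal.sub_mem _ h1 h2))
  have hor : ∀ y, ι y ∈ Q ∨ ι y - 1 ∈ Q := fun y => by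
    have h1 : ι y ^ (t * a) * (ι y - 1) ^ (t * b) ∈ Q := by rw [root_equation h y]; exact hνQ
    exact (hQ.mul_mem_iff_mem_or_mem.1 h1).imp (hQ.mem_of_pow_mem _) (hQ.mem_of_pow_mem _)
  -- The orbit of `x'` under the stabilizer of `x` in the decomposition group lies in the class of
  -- `x` whenever `x'` does.
  have horb : ∀ x x' : Z, x' ∈ swapClass H x → ∀ y ∈ MulAction.orbit
      (MulAction.stabilizer (MulAction.stabilizer G Q) x) x', y ∈ swapClass H x := by
    rintro x x' hx _ ⟨g, rfl⟩
    have hg : ((g : MulAction.stabilizer G Q) : G) • x = x := g.2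
    have h1 := swapClass_apply (H := H)
      (π := MulAction.toPermHom G Z ((g : MulAction.stabilizer G Q) : G)) ⟨_, rfl⟩ x
    rw [MulAction.toPermHom_apply, MulAction.toPerm_apply, hg] at h1
    rw [h1]
    exact Finset.mem_map_of_mem _ hx
  have hmemQ : ∀ x x' : Z, ∀ y ∈ MulAction.orbit
      (MulAction.stabilizer (MulAction.stabilizer G Q) x) x',
      (ι x' ∈ Q → ι y ∈ Q) ∧ (ι x' - 1 ∈ Q → ι y - 1 ∈ Q) := by
    rintro x x' _ ⟨g, rfl⟩
    change (_ → ι (((g : MulAction.stabilizer G Q) : G) • x') ∈ Q) ∧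
      (_ → ι (((g : MulAction.stabilizer G Q) : G) • x') - 1 ∈ Q)
    rw [h.map_smul]
    constructor
    · intro hx
      simpa using smul_sub_constHom_mem (c := 0) (g : MulAction.stabilizer G Q).2
        (by simpa using hx)
    · intro hx
      simpa using smul_sub_constHom_mem (c := 1) (g : MulAction.stabilizer G Q).2
        (by simpa using hx)
  by_cases hmix : ∃ x₀ x₁, ι x₀ ∈ Q ∧ ι x₁ - 1 ∈ Q ∧ x₁ ∈ swapClass H x₀
  · obtain ⟨x₀, x₁, hx₀, hx₁, hxx⟩ := hmix
    have hc₀ := (ncard_orbit_stabilizer h hνQ x₀).1 hx₀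
    have hc₁ := (ncard_orbit_stabilizer h hνQ x₁).2 hx₁
    have hd₁ := card_orbit_dvd_mul_card_orbit_stabilizer (D := MulAction.stabilizer G Q) x₀ x₁
    have hd₀ := card_orbit_dvd_mul_card_orbit_stabilizer (D := MulAction.stabilizer G Q) x₁ x₀
    rw [hc₀, hc₁, mul_assoc, Nat.mul_dvd_mul_iff_left ht] at hd₀ hd₁
    have hb' := Nat.le_of_dvd ((Set.ncard_pos).2 (MulAction.nonempty_orbit x₁))
      (hab.symm.dvd_of_dvd_mul_left hd₁)
    have ha' := Nat.le_of_dvd ((Set.ncard_pos).2 (MulAction.nonempty_orbit x₀))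
      (hab.dvd_of_dvd_mul_left hd₀)
    have hxx' : x₀ ∈ swapClass H x₁ := by
      rw [mem_swapClass] at hxx ⊢; rwa [Equiv.swap_comm]
    refine ⟨x₀, (Nat.add_le_add ha' hb').trans ?_⟩
    rw [← Set.ncard_union_eq, ← Set.ncard_coe_finset]
    · refine Set.ncard_le_ncard (Set.union_subset (fun y hy => ?_) fun y hy => ?_)
      · rw [Finset.mem_coe, ← swapClass_eq_iff.2 hxx]
        exact horb x₁ x₀ hxx' y hy
      · exact horb x₀ x₁ hxx y hy
    · rw [Set.disjoint_left]
      intro y hy hy'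
      exact hnot y ((hmemQ _ _ y hy).1 hx₀) ((hmemQ _ _ y hy').2 hx₁)
  · -- No class mixes the two kinds of roots: its size divides both `a` and `b`, so it is `1`.
    exfalso
    push Not at hmix
    have hwQ : ι z ^ a * (ι z - 1) ^ b ∈ Q := by
      refine hQ.mem_of_pow_mem t ?_
      rw [blockValue_pow h z]; exact hνQ
    have hcard : ∀ c : ℂ, ((block z).filter fun y => ι y - constHom S c ∈ Q).card =
        (X ^ a * (X - 1) ^ b : ℂ[X]).rootMultiplicity c := fun c =>
      card_residue_eq_rootMultiplicity _ _ (by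
        rw [prod_block_eq h ha z, Polynomial.map_sub, map_C, Ideal.Quotient.eq_zero_iff_mem.2 hwQ]
        simp) c
    have hbl : ∀ y ∈ block z, swapClass H y ⊆ block z := fun y hy x hx => by
      have h1 := hsub y hx
      simp only [block, Finset.mem_filter, Finset.mem_univ, true_and] at hy h1 ⊢
      rw [h1, hy]
    have hka : (swapClass H z).card ∣ a := by
      rw [← rootMultiplicity_shape_zero a b, ← hcard 0]
      refine dvd_card_of_swapClass_subset (fun y hy x hx => ?_) fun y _ => hconst y z
      rw [Finset.mem_filter, map_zero, sub_zero] at hy ⊢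
      exact ⟨hbl y hy.1 hx, (hor x).resolve_right fun h1 => hmix y x hy.2 h1 hx⟩
    have hkb : (swapClass H z).card ∣ b := by
      rw [← rootMultiplicity_shape_one a b, ← hcard 1]
      refine dvd_card_of_swapClass_subset (fun y hy x hx => ?_) fun y _ => hconst y z
      rw [Finset.mem_filter, map_one] at hy ⊢
      refine ⟨hbl y hy.1 hx, (hor x).resolve_left fun h1 => hmix x y h1 hy.2 ?_⟩
      rw [mem_swapClass] at hx ⊢; rwa [Equiv.swap_comm]
    have hk1 : (swapClass H z).card = 1 := Nat.eq_one_of_dvd_coprimes hab hka hkb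
    obtain ⟨z₁, z₂, hne, hs⟩ := exists_swap_mem_range h (Nat.mul_pos ht ha) (Nat.mul_pos ht hb)
    rw [hconst z z₁, Finset.card_eq_one] at hk1
    obtain ⟨x, hx⟩ := hk1
    have e1 := self_mem_swapClass (H := H) z₁
    have e2 := mem_swapClass.2 hs
    rw [← hH, hx, Finset.mem_singleton] at e2
    rw [hx, Finset.mem_singleton] at e1
    exact hne (e1.trans e2.symm)

end Primitive

/-! ### Permutations shifting a labelling -/

/-- The permutations of `Z` that shift the values of `f` by a constant. -/
def shiftGroup {Z A : Type*} [AddCommGroup A] (f : Z → A) : Subgroup (Equiv.Perm Z) where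
  carrier := {π | ∃ c, ∀ z, f (π z) = f z + c}
  mul_mem' := by
    rintro π σ ⟨c, hc⟩ ⟨d, hd⟩
    exact ⟨d + c, fun z => by rw [Equiv.Perm.mul_apply, hc, hd, add_assoc]⟩
  one_mem' := ⟨0, fun z => by simp⟩
  inv_mem' := by
    rintro π ⟨c, hc⟩
    refine ⟨-c, fun z => ?_⟩
    have := hc (π.symm z)
    rw [Equiv.apply_symm_apply] at this
    rw [this, add_neg_cancel_right]; rfl

section ShiftGroup

variable {Z A : Type*} [AddCommGroup A] {f : Z → A}

theorem mem_shiftGroup {π : Equiv.Perm Z} : π ∈ shiftGroup f ↔ ∃ c, ∀ z, f (π z) = f z + c :=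
  Iff.rfl

/-- A subgroup with all transpositions within the fibres of `f` contains all permutations that
preserve the fibres of `f`. -/
theorem mem_of_forall_swap_mem [Finite Z] [DecidableEq Z] {H : Subgroup (Equiv.Perm Z)}
    {B : Type*} {f : Z → B} (hswap : ∀ z z', f z = f z' → Equiv.swap z z' ∈ H)
    {π : Equiv.Perm Z} (hπ : ∀ z, f (π z) = f z) : π ∈ H := by
  set T : Set (Equiv.Perm Z) := {σ | σ ∈ H ∧ σ.IsSwap}
  have hT : Subgroup.closure T ≤ H := (Subgroup.closure_le _).2 fun σ hσ => hσ.1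
  refine hT ((_root_.mem_closure_isSwap fun σ hσ => hσ.2).2 ⟨Set.toFinite _, fun z => ?_⟩)
  by_cases hz : z = π z
  · rw [← hz]; exact MulAction.mem_orbit_self z
  · refine ⟨⟨Equiv.swap z (π z), Subgroup.subset_closure ⟨hswap _ _ (hπ z).symm, ?_⟩⟩, ?_⟩
    · exact ⟨z, π z, hz, rfl⟩
    · exact Equiv.swap_apply_left z (π z)

/-- A transitive group of shifts that contains the transpositions within the fibres contains all
shifts: a group element that agrees with a given shift at one point differs from it by a permutation
preserving the fibres. -/
theorem eq_shiftGroup [Finite Z] [DecidableEq Z] {H : Subgroup (Equiv.Perm Z)}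
    (hle : H ≤ shiftGroup f) (hswap : ∀ z z', f z = f z' → Equiv.swap z z' ∈ H)
    (htrans : ∀ z z', ∃ g ∈ H, g z = z') : H = shiftGroup f := by
  refine le_antisymm hle fun π hπ => ?_
  obtain ⟨c, hc⟩ := hπ
  rcases isEmpty_or_nonempty Z with hZ | ⟨⟨z₀⟩⟩
  · rw [Subsingleton.elim π 1]; exact H.one_mem
  obtain ⟨g, hg, hgz⟩ := htrans z₀ (π z₀)
  obtain ⟨d, hd⟩ := hle hg
  have hdc : d = c := by
    have := hd z₀
    rw [hgz, hc z₀] at this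
    exact (add_left_cancel this).symm
  rw [← mul_inv_cancel_left g π]
  refine H.mul_mem hg (mem_of_forall_swap_mem hswap fun z => ?_)
  have h1 := hd (g.symm (π z))
  rw [Equiv.apply_symm_apply, hc z, hdc] at h1
  exact (add_right_cancel h1).symm

end ShiftGroup

section ZModShift

variable {n t : ℕ}

theorem addRight_pow (x : ZMod n) (k : ℕ) :
    (Equiv.addRight x : Equiv.Perm (ZMod n)) ^ k = Equiv.addRight (k * x) := by
  induction k with
  | zero => ext; simp
  | succ k ih => rw [pow_succ, ih]; ext y; simp; ring

theorem castHom_eq_zero_iff [NeZero n] (h : t ∣ n) (x : ZMod n) :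
    ZMod.castHom h (ZMod t) x = 0 ↔ t ∣ x.val := by
  rw [ZMod.castHom_apply, ZMod.cast_eq_val, ZMod.natCast_eq_zero_iff]

/-- The `n`-cycle and a transposition of points at distance `d` generate all permutations that
shift residues modulo `gcd n d`. -/
theorem closure_addRight_swap [NeZero n] (h : t ∣ n) {d : ℕ} (hd : n.gcd d = t) (a : ZMod n) :
    Subgroup.closure {Equiv.addRight (1 : ZMod n), Equiv.swap a (a + (d : ZMod n))} =
      shiftGroup (ZMod.castHom h (ZMod t)) := by
  set H := Subgroup.closure {Equiv.addRight (1 : ZMod n), Equiv.swap a (a + (d : ZMod n))} with hH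
  have hadd : ∀ x : ZMod n, (Equiv.addRight x : Equiv.Perm (ZMod n)) ∈ H := fun x => by
    have h1 : (Equiv.addRight x : Equiv.Perm (ZMod n)) = Equiv.addRight 1 ^ x.val := by
      rw [addRight_pow, ZMod.natCast_zmod_val, mul_one]
    rw [h1]
    exact H.pow_mem (Subgroup.subset_closure (by simp)) _
  have hswap : ∀ i : ZMod n, Equiv.swap i (i + d) ∈ H := fun i => by
    have h1 := Equiv.swap_apply_apply (Equiv.addRight (i - a)) a (a + d)
    simp only [Equiv.coe_addRight] at h1
    rw [add_sub_cancel, add_right_comm, add_sub_cancel] at h1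
    rw [h1]
    exact H.mul_mem (H.mul_mem (hadd _) (Subgroup.subset_closure (by simp))) (H.inv_mem (hadd _))
  have hmul : ∀ (i : ZMod n) (k : ℕ), Equiv.swap i (i + k * d) ∈ H := fun i k => by
    induction k with
    | zero =>
      rw [Nat.cast_zero, zero_mul, add_zero, Equiv.swap_self]
      exact H.one_mem
    | succ k ih =>
      refine SubmonoidClass.swap_mem_trans H ih ?_
      have := hswap (i + k * d)
      rwa [add_assoc, ← add_one_mul, ← Nat.cast_succ] at this
  have htd : ∃ v : ZMod n, (t : ZMod n) = v * d := by
    refine ⟨(n.gcdB d : ℤ), ?_⟩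
    have h1 := congrArg (Int.cast : ℤ → ZMod n) (Nat.gcd_eq_gcd_ab n d)
    rw [hd] at h1
    push_cast at h1
    rw [h1, ZMod.natCast_self, zero_mul, zero_add, mul_comm]
  refine eq_shiftGroup ?_ ?_ fun z z' => ⟨_, hadd (z' - z), by simp⟩
  · rw [hH, Subgroup.closure_le]
    rintro π (rfl | rfl)
    · exact ⟨1, fun z => by rw [Equiv.coe_addRight, map_add, map_one]⟩
    · refine ⟨0, fun z => ?_⟩
      have h0 : ZMod.castHom h (ZMod t) (d : ZMod n) = 0 := by
        rw [map_natCast, ZMod.natCast_eq_zero_iff, ← hd]; exact Nat.gcd_dvd_right n d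
      rw [add_zero]
      rcases eq_or_ne z a with rfl | h1
      · rw [Equiv.swap_apply_left, map_add, h0, add_zero]
      rcases eq_or_ne z (a + d) with rfl | h2
      · rw [Equiv.swap_apply_right, map_add, h0, add_zero]
      · rw [Equiv.swap_apply_of_ne_of_ne h1 h2]
  · intro z z' hzz
    have h1 : ZMod.castHom h (ZMod t) (z' - z) = 0 := by rw [map_sub, hzz, sub_self]
    rw [castHom_eq_zero_iff] at h1
    obtain ⟨k, hk⟩ := h1
    obtain ⟨v, hv⟩ := htd
    have h2 : z' = z + ((k * v : ZMod n).val : ℕ) * d := by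
      rw [ZMod.natCast_zmod_val, mul_assoc, ← hv, ← sub_eq_iff_eq_add',
        ← ZMod.natCast_zmod_val (z' - z), hk]
      push_cast; ring
    rw [h2]
    exact hmul z _

theorem card_castHom_fiber [NeZero n] (h : t ∣ n) (c : ZMod t) :
    Nat.card {x : ZMod n // ZMod.castHom h (ZMod t) x = c} = n / t := by
  classical
  have ht : t ≠ 0 := fun h0 => NeZero.ne n (Nat.eq_zero_of_zero_dvd (h0 ▸ h))
  have : NeZero t := ⟨ht⟩
  have hfib : ∀ c', Nat.card {x : ZMod n // ZMod.castHom h (ZMod t) x = c'} =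
      Nat.card {x : ZMod n // ZMod.castHom h (ZMod t) x = c} := fun c' => by
    obtain ⟨y, hy⟩ := ZMod.castHom_surjective h (c - c')
    refine Nat.card_congr ((Equiv.addRight y).subtypeEquiv fun x => ?_)
    rw [Equiv.coe_addRight, map_add, hy, ← eq_sub_iff_add_eq, sub_sub_cancel]
  have hsum := Nat.card_congr (Equiv.sigmaFiberEquiv (ZMod.castHom h (ZMod t))).symm
  rw [Nat.card_sigma, Finset.sum_congr rfl fun c' _ => hfib c'] at hsum
  simp only [Nat.card_zmod, Finset.sum_const, Finset.card_univ, ZMod.card, smul_eq_mul] at hsum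
  exact (Nat.div_eq_of_eq_mul_right (Nat.pos_of_ne_zero ht) hsum).symm

end ZModShift

/-- The permutations that preserve the fibres of `f`, as the product of the symmetric groups of the
fibres. -/
def fiberPermHom {Z B : Type*} (f : Z → B) : (∀ c, Equiv.Perm {z // f z = c}) →* Equiv.Perm Z where
  toFun g := DomMulAct.mk.symm ((DomMulAct.stabilizerMulEquiv f).symm g).unop.1
  map_one' := by simp
  map_mul' g g' := by simp

theorem fiberPermHom_injective {Z B : Type*} (f : Z → B) : Function.Injective (fiberPermHom f) := by
  intro g g' h
  apply (DomMulAct.stabilizerMulEquiv f).symm.injective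
  apply MulOpposite.unop_injective
  exact Subtype.ext (DomMulAct.mk.symm.injective h)

theorem mem_range_fiberPermHom {Z B : Type*} (f : Z → B) (π : Equiv.Perm Z) :
    π ∈ (fiberPermHom f).range ↔ ∀ z, f (π z) = f z := by
  constructor
  · rintro ⟨g, rfl⟩ z
    exact congrFun ((DomMulAct.mem_stabilizer_iff).1
      ((DomMulAct.stabilizerMulEquiv f).symm g).unop.2) z
  · intro h
    refine ⟨DomMulAct.stabilizerMulEquiv f (MulOpposite.op ⟨DomMulAct.mk π,
      DomMulAct.mem_stabilizer_iff.2 (funext h)⟩), ?_⟩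
    simp [fiberPermHom]

/-- An abstract group whose image is `shiftGroup f` is an extension of `ZMod t`, through the amount
of the shift, by the product of the symmetric groups of the fibres. -/
theorem nonempty_groupExtension_of_range_eq {E Z : Type*} [Group E] [Finite Z] {t m : ℕ} [NeZero t]
    {f : Z → ZMod t} (φ : E →* Equiv.Perm Z) (hφ : Function.Injective φ)
    (hrange : φ.range = shiftGroup f) (z₀ : Z) (hcard : ∀ c, Nat.card {z // f z = c} = m)
    (hshift : ∀ c, ∃ π : Equiv.Perm Z, ∀ z, f (π z) = f z + c) :
    Nonempty (GroupExtension (Fin t → Equiv.Perm (Fin m)) E (Multiplicative (ZMod t))) := by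
  have hE : ∀ g : E, ∃ c, ∀ z, f (φ g z) = f z + c := fun g =>
    mem_shiftGroup.1 (hrange ▸ ⟨g, rfl⟩)
  have hE' : ∀ (g : E) (z : Z), f (φ g z) = f z + (f (φ g z₀) - f z₀) := fun g z => by
    obtain ⟨c, hc⟩ := hE g
    rw [hc z, hc z₀, add_sub_cancel_left]
  let rightHom : E →* Multiplicative (ZMod t) :=
    { toFun := fun g => Multiplicative.ofAdd (f (φ g z₀) - f z₀)
      map_one' := by simp
      map_mul' := fun g g' => by
        rw [← ofAdd_add, map_mul, Equiv.Perm.mul_apply, hE' g (φ g' z₀)]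
        congr 1; ring }
  have hker : ∀ g, g ∈ rightHom.ker ↔ ∀ z, f (φ g z) = f z := fun g => by
    rw [MonoidHom.mem_ker]
    change Multiplicative.ofAdd (f (φ g z₀) - f z₀) = 1 ↔ _
    rw [ofAdd_eq_one, sub_eq_zero]
    exact ⟨fun h z => by rw [hE' g z, h, sub_self, add_zero], fun h => h z₀⟩
  let r : Fin t ≃ ZMod t := Fintype.equivFinOfCardEq (ZMod.card t) |>.symm
  let e : ∀ c, Fin m ≃ {z // f z = c} := fun c => (Finite.equivFinOfCardEq (hcard c)).symm
  let ψ₀ : (Fin t → Equiv.Perm (Fin m)) →* ∀ c, Equiv.Perm {z // f z = c} :=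
    { toFun := fun g c => (e c).permCongrHom (g (r.symm c))
      map_one' := funext fun c => map_one _
      map_mul' := fun g g' => funext fun c => map_mul _ _ _ }
  have hψ₀ : Function.Bijective ψ₀ := by
    constructor
    · intro g g' h
      funext i
      have h1 := congrFun h (r i)
      have h2 := (e (r i)).permCongrHom.injective h1
      simpa using h2
    · intro g
      refine ⟨fun i => (e (r i)).permCongrHom.symm (g (r i)), funext fun c => ?_⟩
      obtain ⟨i, rfl⟩ := r.surjective c
      change (e (r i)).permCongrHom ((e (r (r.symm (r i)))).permCongrHom.symm (g _)) = _
      rw [Equiv.symm_apply_apply, MulEquiv.apply_symm_apply]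
  let ψ := (fiberPermHom f).comp ψ₀
  have hψ : ∀ π, π ∈ ψ.range ↔ ∀ z, f (π z) = f z := fun π => by
    rw [← mem_range_fiberPermHom, MonoidHom.range_comp, (MonoidHom.range_eq_top).2 hψ₀.2,
      ← MonoidHom.range_eq_map]
  have hψφ : ∀ g, ψ g ∈ φ.range := fun g => by
    rw [hrange, mem_shiftGroup]
    exact ⟨0, fun z => by rw [add_zero]; exact (hψ _).1 ⟨g, rfl⟩ z⟩
  let inl : (Fin t → Equiv.Perm (Fin m)) →* E :=
    (MonoidHom.ofInjective hφ).symm.toMonoidHom.comp (ψ.codRestrict φ.range hψφ)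
  have hinl : ∀ g, φ (inl g) = ψ g := fun g => by
    have := (MonoidHom.ofInjective hφ).apply_symm_apply ⟨ψ g, hψφ g⟩
    exact congrArg Subtype.val this
  refine ⟨⟨inl, rightHom, fun g g' h => ?_, ?_, fun c => ?_⟩⟩
  · have h1 : ψ g = ψ g' := by rw [← hinl, ← hinl, h]
    exact hψ₀.1 (fiberPermHom_injective f h1)
  · ext g
    rw [hker, ← hψ]
    constructor
    · rintro ⟨x, rfl⟩; exact ⟨x, (hinl x).symm⟩
    · rintro ⟨x, hx⟩; exact ⟨x, hφ ((hinl x).trans hx)⟩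
  · obtain ⟨π, hπ⟩ := hshift c.toAdd
    obtain ⟨g, rfl⟩ : π ∈ φ.range := by rw [hrange]; exact ⟨_, hπ⟩
    refine ⟨g, ?_⟩
    change Multiplicative.ofAdd (f (φ g z₀) - f z₀) = c
    rw [hπ, add_sub_cancel_left]; rfl

/-! ### The permutations induced on the roots -/

/-- The image of the group in the permutations of the roots consists of all permutations that shift
the index of a block, an integer modulo `t`, by a constant. -/
theorem exists_range_eq_shiftGroup {G S Z : Type*} [CommRing S] [IsDedekindDomain S]
    [Algebra ℂ[X] S] [FaithfulSMul ℂ[X] S] [Group G] [Finite G] [MulSemiringAction G S]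
    [SMulCommClass G ℂ[X] S] [Algebra.IsInvariant ℂ[X] S G] [Fintype Z] [MulAction G Z]
    {ι : Z → S} {a b t : ℕ} (h : IsRootFamily G (t * a) (t * b) ι) (ht : 0 < t) (ha : 0 < a)
    (hab : a.Coprime b) :
    ∃ f : Z → ZMod t, (MulAction.toPermHom G Z).range = shiftGroup f ∧
      ∀ c, Nat.card {z // f z = c} = a + b := by
  classical
  have : NeZero t := ⟨ht.ne'⟩
  set W : Z → S := fun z => ι z ^ a * (ι z - 1) ^ b with hW
  have hparam : param S ≠ 0 := by simpa using param_ne_constHom (S := S) 0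
  have hZ : Fintype.card Z = t * (a + b) := by
    have h1 := congrArg natDegree h.prod_eq
    rw [natDegree_sub_C, natDegree_shape, natDegree_prod_of_monic _ _ fun y _ => monic_X_sub_C _]
      at h1
    simpa [mul_add] using h1
  have hpos : 0 < Fintype.card Z := by rw [hZ]; positivity
  obtain ⟨z₀⟩ := Fintype.card_pos_iff.1 hpos
  have hprim := (Complex.isPrimitiveRoot_exp t ht.ne').map_of_injective
    (f := constHom S) ((FaithfulSMul.algebraMap_injective ℂ[X] S).comp (C_injective))
  set ζ : S := constHom S (Complex.exp (2 * Real.pi * Complex.I / t)) with hζ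
  have hWt : ∀ z, W z ^ t = param S := blockValue_pow h
  have hW0 : W z₀ ≠ 0 := fun h0 => hparam (by rw [← hWt z₀, h0, zero_pow ht.ne'])
  have hex : ∀ z, ∃ i : ℕ, W z = ζ ^ i * W z₀ := fun z => by
    have h1 := hprim.pow_sub_pow_eq_prod_sub_mul (W z) (W z₀) ht
    rw [hWt, hWt, sub_self, eq_comm, Finset.prod_eq_zero_iff] at h1
    obtain ⟨ξ, hξ, h2⟩ := h1
    obtain ⟨i, -, rfl⟩ := hprim.eq_pow_of_pow_eq_one ((mem_nthRootsFinset ht 1).1 hξ)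
    exact ⟨i, sub_eq_zero.1 h2⟩
  choose i hi using hex
  have hpow : ∀ j k : ℕ, ζ ^ j = ζ ^ k ↔ (j : ZMod t) = k := fun j k => by
    rw [ZMod.natCast_eq_natCast_iff]
    have h2 : ζ ^ j = ζ ^ k ↔
        (hprim.isUnit ht.ne').unit ^ j = (hprim.isUnit ht.ne').unit ^ k := by
      rw [Units.ext_iff]; simp
    rw [h2, pow_eq_pow_iff_modEq, ← orderOf_units, IsUnit.unit_spec, ← hprim.eq_orderOf]
  have hf : ∀ z z', (i z : ZMod t) = i z' ↔ W z = W z' := fun z z' => by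
    rw [← hpow, hi z, hi z', mul_left_inj' hW0]
  have hsmul : ∀ (g : G) (z : Z), W (g • z) = g • W z := smul_blockValue h
  have hrange : (MulAction.toPermHom G Z).range = shiftGroup fun z => (i z : ZMod t) := by
    refine eq_shiftGroup ?_ ?_ ?_
    · rintro _ ⟨g, rfl⟩
      refine ⟨i (g • z₀), fun z => ?_⟩
      rw [MulAction.toPermHom_apply, MulAction.toPerm_apply, ← Nat.cast_add, ← hpow]
      apply mul_right_cancel₀ hW0
      rw [← hi, hsmul, hi z, smul_mul', smul_pow', hζ, smul_constHom, ← hζ, ← hsmul, hi (g • z₀)]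
      ring
    · intro z z' hzz
      have hw : W z' = W z := (hf _ _).1 hzz.symm
      rcases Nat.eq_zero_or_pos b with rfl | hb
      · have ha1 : a = 1 := by simpa using hab
        have hz : z' = z := h.injective (by simpa [hW, ha1] using hw)
        rw [hz, Equiv.swap_self]
        exact Subgroup.one_mem _
      · exact swap_mem_range_of_blockValue_eq h ht ha hb hab hw
    · intro z z'
      obtain ⟨g, hg⟩ := exists_smul_eq_of_isRootFamily h z z'
      exact ⟨_, ⟨g, rfl⟩, hg⟩
  refine ⟨fun z => (i z : ZMod t), hrange, ?_⟩
  -- A nonempty fibre is a block, of size `a + b`; since there are `t * (a + b)` roots, none of the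
  -- `t` fibres is empty.
  have hle : ∀ c ∈ (Finset.univ : Finset (ZMod t)),
      Nat.card {z // (i z : ZMod t) = c} ≤ a + b := by
    intro c _
    rcases isEmpty_or_nonempty {z // (i z : ZMod t) = c} with hE | ⟨⟨z, rfl⟩⟩
    · simp
    · rw [← card_block_eq h ha z, Nat.card_eq_fintype_card, Fintype.card_subtype]
      refine (Finset.card_le_card fun y hy => ?_)
      simp only [Finset.mem_filter, Finset.mem_univ, true_and] at hy ⊢
      exact (hf _ _).1 hy
  have hsum := Nat.card_congr (Equiv.sigmaFiberEquiv fun z => (i z : ZMod t))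
  rw [Nat.card_sigma, Nat.card_eq_fintype_card, hZ] at hsum
  have h3 := (Finset.sum_eq_sum_iff_of_le hle).1 (by rw [hsum]; simp [ZMod.card])
  exact fun c => h3 c (Finset.mem_univ c)

/-- The Galois group of `z ^ (t * a) * (z - 1) ^ (t * b) - ν` over a field of fractions `K` of
`ℂ[ν]`; the embedding `φ` of `ℂ[X]` in `K` sends `X` to `ν`. -/
theorem exists_range_eq_shiftGroup_of_isGalois {K L Z : Type*} [Field K] [Field L] [Algebra K L]
    [FiniteDimensional K L] [IsGalois K L] (φ : ℂ[X] →+* K) (hφ : Function.Injective φ)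
    (hfrac : ∀ k : K, ∃ f g, k = φ f / φ g) [Fintype Z] [MulAction (L ≃ₐ[K] L) Z] {u : Z → L}
    (hu : Function.Injective u) (hsmul : ∀ (g : L ≃ₐ[K] L) (z : Z), u (g • z) = g (u z))
    {a b t : ℕ} (hprod : ∏ z, (X - C (u z)) =
      X ^ (t * a) * (X - 1) ^ (t * b) - C (algebraMap K L (φ X)))
    (ht : 0 < t) (ha : 0 < a) (hab : a.Coprime b) :
    ∃ f : Z → ZMod t, (MulAction.toPermHom (L ≃ₐ[K] L) Z).range = shiftGroup f ∧
      ∀ c, Nat.card {z // f z = c} = a + b := by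
  algebraize [φ, (algebraMap K L).comp φ]
  have : FaithfulSMul ℂ[X] K := (faithfulSMul_iff_algebraMap_injective _ _).2 hφ
  have : IsFractionRing ℂ[X] K := IsFractionRing.of_field _ _ hfrac
  have : FaithfulSMul ℂ[X] L := (faithfulSMul_iff_algebraMap_injective _ _).2
    ((algebraMap K L).injective.comp hφ)
  let S := integralClosure ℂ[X] L
  have : IsDedekindDomain S := integralClosure.isDedekindDomain ℂ[X] K L
  have : FaithfulSMul ℂ[X] S := (faithfulSMul_iff_algebraMap_injective _ _).2 fun x y hxy =>
    FaithfulSMul.algebraMap_injective ℂ[X] L (congrArg Subtype.val hxy)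
  have hcomm : SMulCommClass (L ≃ₐ[K] L) ℂ[X] S :=
    ⟨fun g r x => Subtype.ext (smul_comm g r (x : L))⟩
  have : Algebra.IsInvariant ℂ[X] S (L ≃ₐ[K] L) := ⟨fun x hx => by
    have h1 : (x : L) ∈ (⊥ : IntermediateField K L) :=
      (IsGalois.mem_bot_iff_fixed _).2 fun g => congrArg Subtype.val (hx g)
    obtain ⟨k, hk⟩ := IntermediateField.mem_bot.1 h1
    have h2 : IsIntegral ℂ[X] k := by
      rw [← isIntegral_algebraMap_iff (algebraMap K L).injective, hk]; exact x.2
    obtain ⟨r, rfl⟩ := IsIntegrallyClosed.isIntegral_iff.1 h2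
    exact ⟨r, Subtype.ext hk⟩⟩
  have hroot : ∀ z, u z ^ (t * a) * (u z - 1) ^ (t * b) = algebraMap ℂ[X] L X := fun z => by
    have := congrArg (eval (u z)) hprod
    rw [eval_prod, Finset.prod_eq_zero (Finset.mem_univ z) (by simp), eval_sub, eq_comm,
      sub_eq_zero] at this
    change _ = algebraMap K L (φ X)
    simpa using this
  have hint : ∀ z, IsIntegral ℂ[X] (u z) := fun z =>
    ⟨_, monic_shape_sub_C ℂ[X] (Nat.mul_pos ht ha) (t * b) X, by simp [eval₂_pow, hroot]⟩
  have hfam : IsRootFamily (L ≃ₐ[K] L) (t * a) (t * b) fun z => (⟨u z, hint z⟩ : S) := by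
    refine ⟨fun z z' hz => hu (congrArg Subtype.val hz), fun g z => Subtype.ext (hsmul g z), ?_⟩
    apply map_injective (algebraMap S L) Subtype.val_injective
    rw [Polynomial.map_prod]
    simpa using! hprod
  exact exists_range_eq_shiftGroup hfam ht ha hab

/-! ### The inverse of the parameter -/

theorem ratFunc_X_ne_C (c : ℂ) : (RatFunc.X : RatFunc ℂ) ≠ RatFunc.C c := by
  rw [← RatFunc.algebraMap_X, ← RatFunc.algebraMap_C]
  exact fun h => X_ne_C c (RatFunc.algebraMap_injective ℂ h)

/-- The embedding of `ℂ[X]` in `ℂ(λ)` that sends `X` to `s / λ`. -/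
noncomputable def invParamHom (s : ℂ) : ℂ[X] →+* RatFunc ℂ :=
  eval₂RingHom RatFunc.C (RatFunc.C s / RatFunc.X)

theorem invParamHom_injective {s : ℂ} (hs : s ≠ 0) : Function.Injective (invParamHom s) := by
  rw [injective_iff_map_eq_zero]
  intro f hf
  by_contra hf0
  rw [(IsAlgClosed.splits f).eq_prod_roots, map_mul, map_multiset_prod, mul_eq_zero,
    Multiset.prod_eq_zero_iff] at hf
  rcases hf with hf | hf
  · simp [invParamHom, hf0] at hf
  · simp only [Multiset.map_map, Multiset.mem_map] at hf
    obtain ⟨c, -, hc⟩ := hf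
    have hsc : RatFunc.C s ≠ (0 : RatFunc ℂ) := by simpa using hs
    have h1 : RatFunc.C s = RatFunc.C c * (RatFunc.X : RatFunc ℂ) :=
      (div_eq_iff RatFunc.X_ne_zero).1 (by simpa [invParamHom, sub_eq_zero] using hc)
    have hc0 : RatFunc.C c ≠ (0 : RatFunc ℂ) := fun h0 => hsc (by rw [h1, h0, zero_mul])
    refine ratFunc_X_ne_C (s / c) ?_
    rw [map_div₀, h1, mul_div_cancel_left₀ _ hc0]

theorem exists_eq_invParamHom_div {s : ℂ} (hs : s ≠ 0) (k : RatFunc ℂ) :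
    ∃ f g, k = invParamHom s f / invParamHom s g := by
  -- The extension `ψ` of the embedding to `ℂ(λ)` is an involution.
  set ψ : RatFunc ℂ →+* RatFunc ℂ := IsFractionRing.lift (invParamHom_injective hs) with hψ
  have hψf : ∀ f : ℂ[X], ψ (algebraMap ℂ[X] (RatFunc ℂ) f) = invParamHom s f := fun f =>
    IsFractionRing.lift_algebraMap _ f
  have hψC : ∀ c : ℂ, ψ (RatFunc.C c) = RatFunc.C c := fun c => by
    rw [← RatFunc.algebraMap_C, hψf]; simp [invParamHom]
  have hψX : ψ RatFunc.X = RatFunc.C s / RatFunc.X := by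
    rw [← RatFunc.algebraMap_X, hψf]; simp [invParamHom]
  have hinv : ψ.comp ψ = RingHom.id _ := by
    refine IsLocalization.ringHom_ext (nonZeroDivisors ℂ[X]) (ringHom_ext (fun c => ?_) ?_)
    · simp [hψC]
    · have hsc : RatFunc.C s ≠ (0 : RatFunc ℂ) := by simpa using hs
      simp only [RingHom.comp_apply, RatFunc.algebraMap_X, hψX, map_div₀, hψC, RingHom.id_apply]
      rw [div_div_cancel₀ hsc]
  obtain ⟨f, g, -, hfg⟩ := IsFractionRing.div_surjective ℂ[X] (ψ k)
  refine ⟨f, g, ?_⟩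
  rw [← hψf, ← hψf, ← map_div₀, hfg]
  exact (RingHom.congr_fun hinv k).symm

/-! ### The roots of `P` in the coordinate `1 / (x + 1)` -/

section Roots

variable {n p : ℕ}

theorem aeval_parametricPoly {M : Type*} [Field M] [Algebra (RatFunc ℂ) M] (x : M) :
    aeval x (parametricPoly n p) = (x + 1) ^ n - algebraMap (RatFunc ℂ) M RatFunc.X * x ^ p := by
  simp [parametricPoly]

theorem natDegree_X_add_one_pow (n : ℕ) : ((X + 1 : (RatFunc ℂ)[X]) ^ n).natDegree = n := by
  rw [← C_1, (monic_X_add_C _).natDegree_pow, natDegree_X_add_C, mul_one]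

theorem natDegree_parametricPoly (hpn : p < n) : (parametricPoly n p).natDegree = n := by
  rw [parametricPoly, natDegree_sub_eq_left_of_natDegree_lt, natDegree_X_add_one_pow]
  rw [natDegree_X_add_one_pow]
  exact (natDegree_C_mul_X_pow_le _ _).trans_lt hpn

/-- The critical points of `(x + 1) ^ n / x ^ p` are constants, so that they are not roots. -/
theorem separable_parametricPoly (hpn : p < n) : (parametricPoly n p).Separable := by
  rw [separable_def, isCoprime_iff_aeval_ne_zero_of_isAlgClosed _ (AlgebraicClosure (RatFunc ℂ))]
  intro x
  by_contra! hx
  obtain ⟨h1, h2⟩ := hx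
  set l := algebraMap (RatFunc ℂ) (AlgebraicClosure (RatFunc ℂ)) with hl
  rw [aeval_parametricPoly, sub_eq_zero, ← hl] at h1
  have h2' : n * (x + 1) ^ (n - 1) - l RatFunc.X * (p * x ^ (p - 1)) = 0 := by
    simpa [parametricPoly, derivative_pow, ← hl] using h2
  have hX0 : l RatFunc.X ≠ 0 := (map_ne_zero l).2 RatFunc.X_ne_zero
  have hx1 : x + 1 ≠ 0 := fun h => by
    have h3 : x ≠ 0 := fun h0 => by rw [h0] at h; simp at h
    rw [h, zero_pow (by omega)] at h1
    exact mul_ne_zero hX0 (pow_ne_zero p h3) h1.symm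
  have hxn : (x + 1) ^ n = (x + 1) * (x + 1) ^ (n - 1) := by
    rw [← pow_succ', Nat.sub_add_cancel (by omega)]
  have hxp : (p : AlgebraicClosure (RatFunc ℂ)) * x ^ p = p * (x * x ^ (p - 1)) := by
    rcases Nat.eq_zero_or_pos p with rfl | hp
    · simp
    · rw [← pow_succ', Nat.sub_add_cancel hp]
  have h3 : (x + 1) ^ n * (n * x - p * (x + 1)) = 0 := by
    linear_combination x * (x + 1) * h2' + n * x * hxn - (x + 1) * p * h1 -
      (x + 1) * l RatFunc.X * hxp
  have h4 : n * x - p * (x + 1) = 0 := (mul_eq_zero.1 h3).resolve_left (pow_ne_zero n hx1)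
  have hnp : ((n : ℂ) - p) ≠ 0 := sub_ne_zero.2 (by exact_mod_cast hpn.ne')
  set c : ℂ := p / (n - p) with hc
  have hcc : (n - p : ℂ) * c = p := by rw [hc]; field_simp
  have hxc : x = l (RatFunc.C c) := by
    have h5 : l (RatFunc.C (n - p : ℂ)) * l (RatFunc.C c) = p := by
      rw [← map_mul, ← map_mul, hcc]; simp
    have h6 : l (RatFunc.C (n - p : ℂ)) ≠ 0 :=
      (map_ne_zero l).2 ((_root_.map_ne_zero RatFunc.C).2 hnp)
    apply mul_left_cancel₀ h6
    rw [h5]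
    have h7 : l (RatFunc.C (n - p : ℂ)) = n - p := by simp
    rw [h7]
    linear_combination h4
  have hcp : c ^ p ≠ 0 := by
    rcases Nat.eq_zero_or_pos p with h0 | h0
    · rw [h0, pow_zero]; exact one_ne_zero
    · exact pow_ne_zero _ (div_ne_zero (by exact_mod_cast h0.ne') hnp)
  have h8 : RatFunc.C ((c + 1) ^ n) = (RatFunc.X : RatFunc ℂ) * RatFunc.C (c ^ p) := by
    apply l.injective
    rw [hxc] at h1
    simpa using h1
  refine ratFunc_X_ne_C ((c + 1) ^ n / c ^ p) ?_
  rw [map_div₀, h8, mul_div_cancel_right₀ _ (by simpa using hcp)]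

theorem card_parametricRoots (hpn : p < n) : Fintype.card (ParametricRoots n p) = n :=
  (card_rootSet_eq_natDegree (separable_parametricPoly hpn) (SplittingField.splits _)).trans
    (natDegree_parametricPoly hpn)

theorem root_add_one_ne_zero (hpn : p < n) (x : ParametricRoots n p) :
    (x : (parametricPoly n p).SplittingField) + 1 ≠ 0 := fun h => by
  have h1 := (mem_rootSet.1 x.2).2
  rw [aeval_parametricPoly, h, zero_pow (by omega), zero_sub, neg_eq_zero, mul_eq_zero] at h1
  rcases h1 with h1 | h1
  · exact RatFunc.X_ne_zero ((map_eq_zero _).1 h1)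
  · refine pow_ne_zero p (fun h0 => ?_) h1
    rw [h0, zero_add] at h
    exact one_ne_zero h

/-- The coordinate `1 / (x + 1)` of a root `x`. -/
noncomputable def rootCoord (x : ParametricRoots n p) : (parametricPoly n p).SplittingField :=
  ((x : (parametricPoly n p).SplittingField) + 1)⁻¹

theorem rootCoord_injective : Function.Injective (rootCoord (n := n) (p := p)) := fun _ _ h =>
  Subtype.ext (add_right_cancel (inv_injective h))

theorem rootCoord_equation (hpn : p < n) (x : ParametricRoots n p) :
    rootCoord x ^ (n - p) * (rootCoord x - 1) ^ p =
      algebraMap (RatFunc ℂ) _ (invParamHom ((-1) ^ p) X) := by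
  have h1 := (mem_rootSet.1 x.2).2
  have h0 := root_add_one_ne_zero hpn x
  rw [aeval_parametricPoly, sub_eq_zero] at h1
  set l := algebraMap (RatFunc ℂ) (parametricPoly n p).SplittingField with hl
  set y : (parametricPoly n p).SplittingField := x.1
  have hX0 : l RatFunc.X ≠ 0 := (map_ne_zero l).2 RatFunc.X_ne_zero
  have hν : l (invParamHom ((-1) ^ p) X) = (-1) ^ p / l RatFunc.X := by
    simp [invParamHom, map_div₀]
  have h2 : rootCoord x - 1 = -1 * y * rootCoord x := by
    change (y + 1)⁻¹ - 1 = -1 * y * (y + 1)⁻¹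
    field_simp; ring
  have h3 : rootCoord x ^ n * (y + 1) ^ n = 1 := by
    rw [← mul_pow]; change ((y + 1)⁻¹ * (y + 1)) ^ n = 1
    rw [inv_mul_cancel₀ h0, one_pow]
  rw [hν, eq_div_iff hX0, h2, mul_pow, mul_pow]
  have h4 : rootCoord x ^ n = rootCoord x ^ (n - p) * rootCoord x ^ p := by
    rw [← pow_add, Nat.sub_add_cancel hpn.le]
  rw [h1, h4] at h3
  linear_combination (-1) ^ p * h3

theorem prod_rootCoord (hpn : p < n) :
    ∏ x : ParametricRoots n p, (X - C (rootCoord x)) =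
      X ^ (n - p) * (X - 1) ^ p - C (algebraMap (RatFunc ℂ) _ (invParamHom ((-1) ^ p) X)) := by
  symm
  refine eq_of_monic_of_dvd_of_natDegree_le (monic_prod_of_monic _ _ fun x _ => monic_X_sub_C _)
    (monic_shape_sub_C _ (by omega) _ _) ?_ ?_
  · refine Finset.prod_dvd_of_coprime
      (fun x _ y _ hxy => pairwise_coprime_X_sub_C rootCoord_injective hxy) fun x _ => ?_
    rw [dvd_iff_isRoot]
    simp [IsRoot, rootCoord_equation hpn x]
  · rw [natDegree_sub_C, natDegree_shape, natDegree_prod_of_monic _ _ fun y _ => monic_X_sub_C _]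
    simp [card_parametricRoots hpn, hpn.le]

theorem rootAction_injective : Function.Injective (rootAction n p) := fun _ _ h =>
  Gal.ext _ fun x hx => congrArg Subtype.val (Equiv.congr_fun h ⟨x, hx⟩)

theorem rootAction_range {a b t : ℕ} (hpn : p < n) (ht : 0 < t) (ha : 0 < a) (hab : a.Coprime b)
    (hta : t * a = n - p) (htb : t * b = p) :
    ∃ f : ParametricRoots n p → ZMod t, (rootAction n p).range = shiftGroup f ∧
      ∀ c, Nat.card {z // f z = c} = a + b := by
  have hs : ((-1) ^ p : ℂ) ≠ 0 := pow_ne_zero _ (by norm_num)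
  have : IsGalois (RatFunc ℂ) (parametricPoly n p).SplittingField :=
    IsGalois.of_separable_splitting_field (separable_parametricPoly hpn)
  exact exists_range_eq_shiftGroup_of_isGalois (Z := ParametricRoots n p)
    (L := (parametricPoly n p).SplittingField) (invParamHom ((-1) ^ p))
    (invParamHom_injective hs) (exists_eq_invParamHom_div hs) (u := rootCoord) rootCoord_injective
    (fun g x => by
      change ((g (x : (parametricPoly n p).SplittingField)) + 1)⁻¹ = g (_ + 1)⁻¹
      rw [map_inv₀, map_add, map_one]) (by rw [prod_rootCoord hpn, hta, htb]) ht ha hab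

end Roots

/-! ### The Galois group of `P` -/

theorem mainTheorem4 (n p : ℕ) (hpn : p < n) :
    (n.gcd p = 1 →
      Nat.card (ParametricRoots n p) = n ∧ Function.Bijective (rootAction n p)) ∧
    (∀ t : ℕ, n.gcd p = t →
      (∃ (x : ZMod n ≃ ParametricRoots n p) (a : ZMod n),
        labelledGaloisGroup n p x =
            Subgroup.closure {Equiv.addRight (1 : ZMod n), Equiv.swap a (a + (p : ZMod n))} ∧
        labelledGaloisGroup n p x =
            Subgroup.closure {Equiv.addRight (1 : ZMod n), Equiv.swap 1 (1 + (t : ZMod n))}) ∧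
      Nonempty (GroupExtension (Fin t → Equiv.Perm (Fin (n / t)))
        (parametricPoly n p).Gal (Multiplicative (ZMod t)))) := by
  have hn : NeZero n := ⟨by omega⟩
  have key : ∀ t : ℕ, n.gcd p = t → 0 < t ∧
      ∃ f : ParametricRoots n p → ZMod t, (rootAction n p).range = shiftGroup f ∧
        ∀ c, Nat.card {z // f z = c} = n / t := by
    rintro t rfl
    have ht : 0 < n.gcd p := Nat.gcd_pos_of_pos_left p (by omega)
    have hgcd : (n - p).gcd p = n.gcd p := Nat.gcd_sub_self_left hpn.le
    have hcop := Nat.coprime_div_gcd_div_gcd (hgcd.symm ▸ ht : 0 < (n - p).gcd p)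
    rw [hgcd] at hcop
    have hta : n.gcd p * ((n - p) / n.gcd p) = n - p :=
      Nat.mul_div_cancel' (hgcd ▸ Nat.gcd_dvd_left (n - p) p)
    have htb : n.gcd p * (p / n.gcd p) = p := Nat.mul_div_cancel' (Nat.gcd_dvd_right n p)
    obtain ⟨f, hf, hcard⟩ := rootAction_range hpn ht
      (Nat.pos_of_ne_zero fun h0 => by rw [h0] at hta; omega) hcop hta htb
    refine ⟨ht, f, hf, fun c => (hcard c).trans ?_⟩
    rw [eq_comm, Nat.div_eq_iff_eq_mul_right ht (Nat.gcd_dvd_left n p), mul_add, hta, htb]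
    omega
  refine ⟨fun h1 => ?_, fun t ht => ?_⟩
  · obtain ⟨-, f, hf, -⟩ := key 1 h1
    refine ⟨by rw [Nat.card_eq_fintype_card, card_parametricRoots hpn], rootAction_injective, ?_⟩
    rw [← MonoidHom.range_eq_top, hf, eq_top_iff]
    exact fun π _ => ⟨0, fun z => Subsingleton.elim _ _⟩
  · obtain ⟨htpos, f, hf, hcard⟩ := key t ht
    have : NeZero t := ⟨htpos.ne'⟩
    have htn : t ∣ n := ht ▸ Nat.gcd_dvd_left n p
    set r := ZMod.castHom htn (ZMod t) with hr
    have e : ∀ c, {i : ZMod n // r i = c} ≃ {z // f z = c} := fun c =>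
      (Finite.equivFinOfCardEq (card_castHom_fiber htn c)).trans
        (Finite.equivFinOfCardEq (hcard c)).symm
    set x : ZMod n ≃ ParametricRoots n p := Equiv.ofFiberEquiv e with hx
    have hfx : ∀ i, f (x i) = r i := fun i => Equiv.ofFiberEquiv_map e i
    have hlab : labelledGaloisGroup n p x = shiftGroup r := by
      ext π
      rw [labelledGaloisGroup, MonoidHom.range_comp, hf, Subgroup.mem_map]
      constructor
      · rintro ⟨σ, ⟨c, hc⟩, rfl⟩
        refine ⟨c, fun i => ?_⟩
        change r (x.symm (σ (x i))) = r i + c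
        rw [← hfx, ← hfx, Equiv.apply_symm_apply, hc]
      · rintro ⟨c, hc⟩
        refine ⟨x.permCongr π, ⟨c, fun z => ?_⟩, ?_⟩
        · rw [Equiv.permCongr_apply, hfx, hc, ← hfx, Equiv.apply_symm_apply]
        · ext i
          change x.symm (x (π (x.symm (x i)))) = π i
          rw [Equiv.symm_apply_apply, Equiv.symm_apply_apply]
    refine ⟨⟨x, 1, ?_, ?_⟩, ?_⟩
    · rw [hlab, closure_addRight_swap htn ht]
    · rw [hlab, closure_addRight_swap htn (Nat.gcd_eq_right htn)]
    · refine nonempty_groupExtension_of_range_eq (rootAction n p) rootAction_injective hf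
        (x 0) hcard fun c => ?_
      obtain ⟨y, rfl⟩ := ZMod.castHom_surjective htn c
      refine ⟨x.permCongr (Equiv.addRight y), fun z => ?_⟩
      rw [Equiv.permCongr_apply, hfx, Equiv.coe_addRight, map_add, ← hr, ← hfx,
        Equiv.apply_symm_apply]
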